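/- Consider the Einstein--Vlasov system ($G=c=1$, no cosmological constant, particles of unit mass) with Bianchi V symmetry. The spacetime metric is $-dt^2+g_{ab}(t)W^aW^b$, where $W^a$ is dual to a left-invariant frame $E_a$ with $[E_b,E_c]=C^d_{bc}E_d$, $C^d_{bc}=a_b\delta^d_c-a_c\delta^d_b$, $a=(1,0,0)$. The distribution function $f(t,p_1,p_2,p_3)\ge 0$ depends only on $t$ and the covariant frame components of the momentum and has compact support in $p$ for each $t$. With the second fundamental form $k_{ab}=-\tfrac12\dot g_{ab}$, $k=g^{ab}k_{ab}$, $p^0=(1+g^{ab}p_ap_b)^{1/2}$, Ricci tensor $R_{ab}$ and scalar curvature $R$ of $g_{ab}$, and $$\rho=\int \frac{f\,p^0}{\sqrt{\det g}}\,dp_1dp_2dp_3,\quad j_a=\int \frac{f\,p_a}{\sqrt{\det g}}\,dp_1dp_2dp_3,\quad S_{ab}=\int \frac{f\,p_ap_b}{p^0\sqrt{\det g}}\,dp_1dp_2dp_3,\quad S=g^{ab}S_{ab},$$ the system reads $$\dot k_{ab}=R_{ab}+k\,k_{ab}-2k_{ac}k^c_b-8\pi(S_{ab}-\tfrac12g_{ab}S)-4\pi\rho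 g_{ab},$$ $$R-k_{ab}k^{ab}+k^2=16\pi\rho,\qquad \nabla^ak_{ab}=8\pi j_b,\qquad \partial_tf+(p^0)^{-1}C^d_{ba}p^bp_d\,\partial f/\partial p_a=0.$$ Put $H=-k/3$, $\sigma_{ab}=k_{ab}+Hg_{ab}$, $\Sigma^b_a=\sigma^b_a/H$, $\Sigma_+=-\tfrac12(\Sigma^2_2+\Sigma^3_3)$, $\Sigma_-=-\tfrac1{2\sqrt3}(\Sigma^2_2-\Sigma^3_3)$, $\tilde A=1+R/(6H^2)$ and $\mathrm P(t)=\sup\{(g^{ab}p_ap_b)^{1/2}: f(t,p)\neq0\}$ (with $\mathrm P=0$ if $f(t,\cdot)=0$). There is a constant $\delta>0$ such that the following holds. Let $(g,k,f)$ be any $C^\infty$ solution of this system on $[t_0,\infty)$, with the time origin chosen so that $t_0=-3/k(t_0)>0$. Assume that $|\Sigma_+(t_0)|$, $|\Sigma_-(t_0)|$, $|\Sigma^i_j(t_0)|$ for all $i\ne j$, $|\tilde A(t_0)|$ and $\mathrm P(t_0)$ are all less than $\delta$. Then there are arbitrarily small constants $\epsilon>0$ (that is, for every $\epsilon_0>0$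 there is such an $\epsilon\in(0,\epsilon_0)$) for which, as $t\to\infty$, \begin{align*} H(t)&=t^{-1}(1+O(t^{-\epsilon})), & \Sigma_+&=O(t^{-2+\epsilon}), & \Sigma_-&=O(t^{-2+\epsilon}),\\ \Sigma^i_j&=O(t^{-2+\epsilon})\ \ (i\ne j), & \tilde A&=O(t^{-\epsilon}), & \mathrm P(t)&=O(t^{-1/2+\epsilon}). \end{align*} -/

import Mathlib

open Set Filter Asymptotics Matrix
open scoped BigOperators ContDiff

noncomputable section

namespace BianchiV

/-- Frame components of a spatial 2-tensor; the frame indices 1, 2, 3 are `0`, `1`, `2 : Fin 3`. -/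
abbrev Mat3 : Type := Matrix (Fin 3) (Fin 3) ℝ

/-- Covariant momenta `(p₁, p₂, p₃)` in the left-invariant frame. -/
abbrev Mom : Type := Fin 3 → ℝ

/-! ### Geometry of a left-invariant metric on the Bianchi V group -/

/-- The vector `a = (1, 0, 0)` of the Bianchi class B decomposition. -/
def aVec : Fin 3 → ℝ := ![1, 0, 0]

/-- Kronecker delta. -/
def kron (i j : Fin 3) : ℝ := if i = j then 1 else 0

/-- Structure constants `C^d_{bc} = a_b δ^d_c - a_c δ^d_b` of Bianchi type V (the class B form
with `ν = 0`), in the left-invariant frame: `[E_b, E_c] = C^d_{bc} E_d`. -/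
def strC (d b c : Fin 3) : ℝ := aVec b * kron d c - aVec c * kron d b

/-- Levi-Civita connection, `Γ_{abc} = g(E_a, ∇_{E_c} E_b)`, by the Koszul formula in the
left-invariant frame (where the metric components are constant in space). -/
def connLow (g : Mat3) (a b c : Fin 3) : ℝ :=
  (1 / 2) * ∑ d, (strC d c b * g a d + strC d a c * g b d - strC d b a * g c d)

/-- `Γ^a_{bc}`, that is `∇_{E_c} E_b = Γ^a_{bc} E_a`. -/
def conn (g : Mat3) (a b c : Fin 3) : ℝ := ∑ d, g⁻¹ a d * connLow g d b c

/-- Ricci tensor `R_{bd} = R^a_{bad}`, where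
`R(E_c, E_d) E_b = ∇_c ∇_d E_b - ∇_d ∇_c E_b - ∇_{[E_c, E_d]} E_b = R^a_{bcd} E_a`. -/
def ricci (g : Mat3) (b d : Fin 3) : ℝ :=
  ∑ a, ∑ e, (conn g e b d * conn g a e a - conn g e b a * conn g a e d - strC e a d * conn g a b e)

/-- The trace `g^{ab} T_{ab}`. -/
def tr (g T : Mat3) : ℝ := ∑ a, ∑ b, g⁻¹ a b * T a b

/-- The mixed components `T^b_a = g^{bc} T_{ca}`, upper index first. -/
def mixed (g T : Mat3) (b a : Fin 3) : ℝ := ∑ c, g⁻¹ b c * T c a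

/-- The scalar curvature `R`. -/
def scalarCurv (g : Mat3) : ℝ := tr g (fun a b => ricci g a b)

/-- The full contraction `T_{ab} T^{ab}`. -/
def normSq (g T : Mat3) : ℝ := ∑ a, ∑ b, ∑ c, ∑ d, g⁻¹ a c * g⁻¹ b d * T a b * T c d

/-- The covariant derivative `∇_c T_{ab}` of a left-invariant 2-tensor. -/
def covDeriv (g T : Mat3) (c a b : Fin 3) : ℝ :=
  -∑ d, (conn g d a c * T d b + conn g d b c * T a d)

/-- The divergence `∇^a T_{ab} = g^{ac} ∇_c T_{ab}`. -/
def diverg (g T : Mat3) (b : Fin 3) : ℝ := ∑ a, ∑ c, g⁻¹ a c * covDeriv g T c a b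

/-! ### Matter -/

/-- `|p|² = g^{ab} p_a p_b`. -/
def momSq (g : Mat3) (p : Mom) : ℝ := ∑ a, ∑ b, g⁻¹ a b * p a * p b

/-- `p⁰` on the unit mass shell. -/
def pZero (g : Mat3) (p : Mom) : ℝ := Real.sqrt (1 + momSq g p)

/-- `p^b = g^{bc} p_c`. -/
def momUp (g : Mat3) (p : Mom) (b : Fin 3) : ℝ := ∑ c, g⁻¹ b c * p c

/-- Energy density `ρ = T^{00} = ∫ f p⁰ √(det g) dp¹dp²dp³`. Here and below the integral is taken
over the covariant momenta: `√(det g) dp¹dp²dp³ = (√(det g))⁻¹ dp₁dp₂dp₃`. -/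
def rho (g : Mat3) (f : Mom → ℝ) : ℝ := (Real.sqrt g.det)⁻¹ * ∫ p : Mom, f p * pZero g p

/-- Matter current `j_a = T_a^0 = -T_{0a} = ∫ f p_a √(det g) dp¹dp²dp³`. -/
def current (g : Mat3) (f : Mom → ℝ) (a : Fin 3) : ℝ :=
  (Real.sqrt g.det)⁻¹ * ∫ p : Mom, f p * p a

/-- Spatial stress `S_{ab} = T_{ab} = ∫ f p_a p_b (p⁰)⁻¹ √(det g) dp¹dp²dp³`. -/
def stress (g : Mat3) (f : Mom → ℝ) : Mat3 := fun a b =>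
  (Real.sqrt g.det)⁻¹ * ∫ p : Mom, f p * p a * p b / pZero g p

/-! ### The Einstein-Vlasov system with Bianchi V symmetry -/

/-- `(g, k, f)` is a `C^∞` solution on `[t₀, ∞)` of the Einstein-Vlasov system with Bianchi V
symmetry (unit-mass particles, `G = c = 1`, no cosmological constant): the spacetime metric is
`-dt² + g_{ab}(t) W^a W^b` with `W^a` dual to the left-invariant frame, `k` is the second
fundamental form of the surfaces of constant `t`, and `f(t, p₁, p₂, p₃) ≥ 0` is the particle
distribution function, compactly supported in momentum at each time. -/
structure IsSolution (t₀ : ℝ) (g k : ℝ → Mat3) (f : ℝ → Mom → ℝ) : Prop where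
  metric_posDef : ∀ t, t₀ ≤ t → (g t).PosDef
  metric_smooth : ∀ a b, ContDiffOn ℝ ∞ (fun t => g t a b) (Ici t₀)
  second_smooth : ∀ a b, ContDiffOn ℝ ∞ (fun t => k t a b) (Ici t₀)
  density_smooth : ContDiffOn ℝ ∞ (fun x : ℝ × Mom => f x.1 x.2) (Ici t₀ ×ˢ univ)
  density_nonneg : ∀ t, t₀ ≤ t → ∀ p, 0 ≤ f t p
  density_compact : ∀ t, t₀ ≤ t → HasCompactSupport (f t)
  /-- `∂ₜ g_{ab} = -2 k_{ab}` -/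
  metric_evol : ∀ t, t₀ ≤ t → ∀ a b,
    HasDerivWithinAt (fun s => g s a b) (-2 * k t a b) (Ici t₀) t
  /-- `∂ₜ k_{ab} = R_{ab} + k k_{ab} - 2 k_{ac} k^c_b - 8π (S_{ab} - ½ g_{ab} S) - 4πρ g_{ab}` -/
  second_evol : ∀ t, t₀ ≤ t → ∀ a b,
    HasDerivWithinAt (fun s => k s a b)
      (ricci (g t) a b + tr (g t) (k t) * k t a b - 2 * ∑ c, k t a c * mixed (g t) (k t) c b
        - 8 * Real.pi * (stress (g t) (f t) a b
            - (1 / 2) * g t a b * tr (g t) (stress (g t) (f t)))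
        - 4 * Real.pi * rho (g t) (f t) * g t a b) (Ici t₀) t
  /-- `R - k_{ab} k^{ab} + k² = 16πρ` -/
  hamiltonian : ∀ t, t₀ ≤ t →
    scalarCurv (g t) - normSq (g t) (k t) + tr (g t) (k t) ^ 2 = 16 * Real.pi * rho (g t) (f t)
  /-- `∇^a k_{ab} = 8π j_b` -/
  momentum : ∀ t, t₀ ≤ t → ∀ b, diverg (g t) (k t) b = 8 * Real.pi * current (g t) (f t) b
  /-- `∂ₜ f + (p⁰)⁻¹ C^d_{ba} p^b p_d ∂f/∂p_a = 0` -/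
  vlasov : ∀ t, t₀ ≤ t → ∀ p,
    HasDerivWithinAt (fun s => f s p)
      (-∑ a, (pZero (g t) p)⁻¹ * (∑ b, ∑ d, strC d b a * momUp (g t) p b * p d)
        * fderiv ℝ (f t) p (Pi.single a 1)) (Ici t₀) t

/-! ### The variables -/

/-- Hubble parameter `H = -k/3`, with `k = g^{ab} k_{ab}`. -/
def hubble (g k : Mat3) : ℝ := -(1 / 3) * tr g k

/-- The trace-free part `σ_{ab} = k_{ab} + H g_{ab}`. -/
def shear (g k : Mat3) : Mat3 := fun a b => k a b + hubble g k * g a b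

/-- `Σ^b_a = σ^b_a / H`, upper index first. -/
def Sig (g k : Mat3) (b a : Fin 3) : ℝ := mixed g (shear g k) b a / hubble g k

/-- `Σ₊ = -½ (Σ²₂ + Σ³₃)`. -/
def SigPlus (g k : Mat3) : ℝ := -(1 / 2) * (Sig g k 1 1 + Sig g k 2 2)

/-- `Σ₋ = -(Σ²₂ - Σ³₃) / (2√3)`. -/
def SigMinus (g k : Mat3) : ℝ := -(1 / (2 * Real.sqrt 3)) * (Sig g k 1 1 - Sig g k 2 2)

/-- `Ã = 1 - A`, where `A = -R / (6H²)`. -/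
def ATilde (g k : Mat3) : ℝ := 1 - (-scalarCurv g / (6 * hubble g k ^ 2))

/-- `P = sup { |p| : f(p) ≠ 0 }`; it is `0` if there are no particles. -/
def maxMom (g : Mat3) (f : Mom → ℝ) : ℝ := sSup {r | ∃ p : Mom, f p ≠ 0 ∧ r = Real.sqrt (momSq g p)}

end BianchiV

end

/-! Why solutions stay close to the Milne model. A left-invariant metric of type V has constant
curvature (`ricci_eq`), so the Ricci tensor has no trace-free part: in `hasDeriv_shearSq` the
quantity |σ|² = σ_ab σ^ab is damped at rate 6H and driven only by the stress. The Hamiltonian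
constraint reads 6H²Ã = |σ|² + 16πρ (`six_hubble_sq_mul_ATilde`). Both terms on the right are
nonnegative, so the single scalar Ã controls shear and density. Finally R = -6 g^{00} in the indices
of `Fin 3`, and the momentum constraint turns σ^{00}, the shear component that drives g^{00}, into a
matter current (`shear_upper_zero`) of size at most √(g^{00}) Q ρ, where Q bounds |p| on the
support. Together these give Ã' ≤ -H Ã (1 - Ã - 2Q) (`hasDeriv_ATilde`).

For a frozen metric |p|² is constant along the Vlasov field, so on the support it shrinks at rate at
least 2H - 2|σ| (`density_support`, by the maximum principle `transport_support` rather than by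
characteristics). A bootstrap closes (`small_data`): small Ã forces |σ| ≤ H/10, hence shrinking
momenta, and small momenta make Ã decrease.

Rates: (1/H)' lies between 1 and 1 + 2Ã, so H is comparable to 1/t. Then Ã = O(t^{-1/2}), P² =
O(t^{-3/2}) and S = O(H² Ã P²) = O(t^{-4}) (`first_decay`). These crude rates suffice: now Ht → 1
and |σ|/H → 0, so up to a loss of ε each quantity follows its vacuum rate, |σ|² = O(t^{-6+ε}),
g^{ii} = O(t^{-2+ε/2}), g_jj = O(t^{2+ε/2}). The inequality (σ^i_j)² ≤ |σ|² g^{ii} g_jj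
(`sq_inv_mul_shear_le`) then yields `shear_decay`. -/

namespace BianchiV

/-! ### Algebra of a left-invariant metric -/

lemma transpose_eq_of_posDef {g : Mat3} (hg : g.PosDef) : gᵀ = g := by
  have := hg.isHermitian.eq
  rwa [conjTranspose_eq_transpose_of_trivial] at this

lemma symm_of_posDef {g : Mat3} (hg : g.PosDef) (a b : Fin 3) : g a b = g b a :=
  congrFun (congrFun (transpose_eq_of_posDef hg) b) a

lemma inv_symm {g : Mat3} (hg : g.PosDef) (a b : Fin 3) : g⁻¹ a b = g⁻¹ b a :=
  symm_of_posDef hg.inv a b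

lemma isUnit_det_of_posDef {g : Mat3} (hg : g.PosDef) : IsUnit g.det :=
  (Matrix.isUnit_iff_isUnit_det g).1 hg.isUnit

lemma inv_mul_of_posDef {g : Mat3} (hg : g.PosDef) : g⁻¹ * g = 1 :=
  nonsing_inv_mul g (isUnit_det_of_posDef hg)

lemma sum_inv_mul {g : Mat3} (hg : g.PosDef) (a b : Fin 3) :
    g⁻¹ a 0 * g 0 b + g⁻¹ a 1 * g 1 b + g⁻¹ a 2 * g 2 b = kron a b := by
  have := congrFun (congrFun (inv_mul_of_posDef hg) a) b
  rw [Matrix.mul_apply, Fin.sum_univ_three, Matrix.one_apply] at this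
  exact this

/-- In the Koszul sum the two terms a_c g_ab cancel and the remaining ones double. -/
lemma connLow_eq {g : Mat3} (hg : g.PosDef) (a b c : Fin 3) :
    connLow g a b c = aVec a * g b c - aVec b * g a c := by
  have h01 := symm_of_posDef hg 0 1
  have h02 := symm_of_posDef hg 0 2
  have h12 := symm_of_posDef hg 1 2
  fin_cases a <;> fin_cases b <;> fin_cases c <;>
    simp [connLow, strC, kron, aVec, Fin.sum_univ_three, h01, h02, h12] <;> ring

lemma conn_eq {g : Mat3} (hg : g.PosDef) (a b c : Fin 3) :
    conn g a b c = g⁻¹ a 0 * g b c - aVec b * kron a c := by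
  have h := sum_inv_mul hg a c
  simp only [conn, connLow_eq hg, Fin.sum_univ_three]
  have h0 : aVec 0 = 1 := rfl
  have h1 : aVec 1 = 0 := rfl
  have h2 : aVec 2 = 0 := rfl
  rw [← h, h0, h1, h2]
  ring

/-- A left-invariant metric on the Bianchi V group has constant curvature. -/
lemma ricci_eq {g : Mat3} (hg : g.PosDef) (b d : Fin 3) :
    ricci g b d = -2 * g⁻¹ 0 0 * g b d := by
  have e00 := sum_inv_mul hg 0 0
  have e01 := sum_inv_mul hg 0 1
  have e02 := sum_inv_mul hg 0 2
  have s01 := symm_of_posDef hg 0 1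
  have s02 := symm_of_posDef hg 0 2
  have s12 := symm_of_posDef hg 1 2
  have t01 := inv_symm hg 0 1
  have t02 := inv_symm hg 0 2
  have t12 := inv_symm hg 1 2
  simp only [ricci, conn_eq hg, Fin.sum_univ_three, strC]
  simp only [kron] at *
  fin_cases b <;> fin_cases d <;> simp [aVec] at * <;> grind

lemma scalarCurv_eq {g : Mat3} (hg : g.PosDef) : scalarCurv g = -6 * g⁻¹ 0 0 := by
  have e0 := sum_inv_mul hg 0 0
  have e1 := sum_inv_mul hg 1 1
  have e2 := sum_inv_mul hg 2 2
  simp only [kron, if_true] at e0 e1 e2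
  simp only [scalarCurv, tr, ricci_eq hg, Fin.sum_univ_three]
  rw [symm_of_posDef hg 0 1, symm_of_posDef hg 0 2, symm_of_posDef hg 1 2] at *
  linear_combination (-2 * g⁻¹ 0 0) * (e0 + e1 + e2)

lemma tr_eq_trace (g T : Mat3) (hT : Tᵀ = T) : tr g T = trace (g⁻¹ * T) := by
  have hs : ∀ a b, T a b = T b a := fun a b => congrFun (congrFun hT b) a
  simp only [tr, trace, diag, Matrix.mul_apply]
  exact Finset.sum_congr rfl fun a _ => Finset.sum_congr rfl fun b _ => by rw [hs a b]

lemma mixed_eq (g T : Mat3) (a b : Fin 3) : mixed g T a b = (g⁻¹ * T) a b := by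
  simp only [mixed, Matrix.mul_apply]

lemma normSq_eq_trace {g : Mat3} (hg : g.PosDef) (T : Mat3) (hT : Tᵀ = T) :
    normSq g T = trace (g⁻¹ * T * (g⁻¹ * T)) := by
  have hs : ∀ a b, T a b = T b a := fun a b => congrFun (congrFun hT b) a
  have s01 := hs 0 1
  have s02 := hs 0 2
  have s12 := hs 1 2
  have t01 := inv_symm hg 0 1
  have t02 := inv_symm hg 0 2
  have t12 := inv_symm hg 1 2
  simp only [normSq, trace, diag, Matrix.mul_apply, Fin.sum_univ_three, s01, s02, s12, t01, t02,
    t12]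
  ring

/-- The divergence of a symmetric left-invariant tensor on the Bianchi V group. -/
lemma diverg_eq {g : Mat3} (hg : g.PosDef) (T : Mat3) (hT : Tᵀ = T) (b : Fin 3) :
    diverg g T b = -(3 * (g⁻¹ * T) 0 b - aVec b * tr g T) := by
  have hs : ∀ a b, T a b = T b a := fun a b => congrFun (congrFun hT b) a
  -- The connection enters the divergence only through two contractions with g^{ac}: over both lower
  -- slots here, over the derivative slot alone in `hb`.
  have ha : ∀ d, ∑ a, ∑ c, g⁻¹ a c * conn g d a c = 2 * g⁻¹ d 0 := by
    intro d
    have e0 := sum_inv_mul hg 0 0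
    have e1 := sum_inv_mul hg 1 1
    have e2 := sum_inv_mul hg 2 2
    have s01 := symm_of_posDef hg 0 1
    have s02 := symm_of_posDef hg 0 2
    have s12 := symm_of_posDef hg 1 2
    have t01 := inv_symm hg 0 1
    have t02 := inv_symm hg 0 2
    have t12 := inv_symm hg 1 2
    simp only [conn_eq hg, Fin.sum_univ_three]
    simp only [kron] at *
    fin_cases d <;> simp [aVec] at * <;> grind
  have hb : ∀ a d, ∑ c, g⁻¹ a c * conn g d b c = g⁻¹ d 0 * kron a b - aVec b * g⁻¹ a d := by
    intro a d
    have e := sum_inv_mul hg a b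
    simp only [conn_eq hg, Fin.sum_univ_three]
    rw [symm_of_posDef hg 0 b, symm_of_posDef hg 1 b, symm_of_posDef hg 2 b] at e
    rw [← e]
    fin_cases d <;> simp [kron] <;> ring
  have expand : diverg g T b = -(∑ d, (∑ a, ∑ c, g⁻¹ a c * conn g d a c) * T d b) -
      ∑ a, ∑ d, (∑ c, g⁻¹ a c * conn g d b c) * T a d := by
    simp only [diverg, covDeriv, Fin.sum_univ_three]
    ring
  rw [expand]
  simp only [ha, hb]
  simp only [tr, Matrix.mul_apply, Fin.sum_univ_three]
  have t01 := inv_symm hg 0 1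
  have t02 := inv_symm hg 0 2
  have s01 := hs 0 1
  have s02 := hs 0 2
  have s12 := hs 1 2
  simp only [kron]
  fin_cases b <;> simp [aVec, t01, t02, s01, s02, s12] <;> ring

/-! ### Cauchy-Schwarz inequalities for positive semidefinite forms. -/

open scoped MatrixOrder Matrix.Norms.L2Operator in
lemma exists_eq_transpose_mul_self {h : Mat3} (hh : h.PosSemidef) : ∃ B : Mat3, h = Bᵀ * B := by
  obtain ⟨B, hB⟩ := CStarAlgebra.nonneg_iff_eq_star_mul_self.mp hh.nonneg
  exact ⟨B, by rw [hB, star_eq_conjTranspose, conjTranspose_eq_transpose_of_trivial]⟩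

lemma sq_dotProduct_mulVec_le {h : Mat3} (hh : h.PosSemidef) (p r : Mom) :
    (p ⬝ᵥ h *ᵥ r) ^ 2 ≤ (p ⬝ᵥ h *ᵥ p) * (r ⬝ᵥ h *ᵥ r) := by
  obtain ⟨B, rfl⟩ := exists_eq_transpose_mul_self hh
  have e : ∀ p r : Mom, p ⬝ᵥ (Bᵀ * B) *ᵥ r = ∑ i, (B *ᵥ p) i * (B *ᵥ r) i := by
    intro p r
    rw [← Matrix.mulVec_mulVec, Matrix.dotProduct_mulVec, Matrix.vecMul_transpose]
    rfl
  rw [e, e, e]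
  simpa only [← sq] using Finset.sum_mul_sq_le_sq_mul_sq Finset.univ (B *ᵥ p) (B *ᵥ r)

/-- Cauchy-Schwarz for a symmetric tensor contracted with two covectors. -/
lemma contract_sq_le {h T : Mat3} (hh : h.PosSemidef) (hT : Tᵀ = T) (p r : Mom) :
    (p ⬝ᵥ (h * T * h) *ᵥ r) ^ 2 ≤
      trace (h * T * (h * T)) * (p ⬝ᵥ h *ᵥ p) * (r ⬝ᵥ h *ᵥ r) := by
  obtain ⟨B, rfl⟩ := exists_eq_transpose_mul_self hh
  -- `τ` is `T` in coordinates where `h` is Euclidean. Its Frobenius norm is the full contraction of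
  -- `T`, and the claim is Cauchy-Schwarz over pairs of indices.
  set τ : Mat3 := B * T * Bᵀ with hτ
  have hτs : τᵀ = τ := by simp [hτ, Matrix.mul_assoc, hT]
  have e1 : trace (Bᵀ * B * T * (Bᵀ * B * T)) = ∑ i, ∑ j, τ i j ^ 2 := by
    have : trace (Bᵀ * B * T * (Bᵀ * B * T)) = trace (τ * τ) := by
      rw [show Bᵀ * B * T * (Bᵀ * B * T) = Bᵀ * (B * T * Bᵀ * (B * T)) by
        simp only [Matrix.mul_assoc], trace_mul_comm]
      congr 1
      simp only [hτ, Matrix.mul_assoc]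
    rw [this]
    simp only [trace, diag, Matrix.mul_apply]
    refine Finset.sum_congr rfl fun i _ => Finset.sum_congr rfl fun j _ => ?_
    rw [sq, show τ j i = τ i j from congrFun (congrFun hτs i) j]
  have e2 : ∀ p r : Mom, p ⬝ᵥ (Bᵀ * B) *ᵥ r = ∑ i, (B *ᵥ p) i * (B *ᵥ r) i := by
    intro p r
    rw [← Matrix.mulVec_mulVec, Matrix.dotProduct_mulVec, Matrix.vecMul_transpose]
    rfl
  have e3 : p ⬝ᵥ (Bᵀ * B * T * (Bᵀ * B)) *ᵥ r = ∑ i, ∑ j, τ i j * ((B *ᵥ p) i * (B *ᵥ r) j) := by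
    rw [show Bᵀ * B * T * (Bᵀ * B) = Bᵀ * (τ * B) by simp only [hτ, Matrix.mul_assoc],
      ← Matrix.mulVec_mulVec, Matrix.dotProduct_mulVec, Matrix.vecMul_transpose,
      ← Matrix.mulVec_mulVec]
    simp only [dotProduct]
    refine Finset.sum_congr rfl fun i _ => ?_
    simp only [mulVec, dotProduct, Finset.mul_sum]
    refine Finset.sum_congr rfl fun j _ => ?_
    ring_nf
  have key := Finset.sum_mul_sq_le_sq_mul_sq (Finset.univ ×ˢ Finset.univ)
    (fun q : Fin 3 × Fin 3 => τ q.1 q.2) (fun q => (B *ᵥ p) q.1 * (B *ᵥ r) q.2)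
  simp only [Finset.sum_product, mul_pow] at key
  rw [e1, e2, e2, e3, mul_assoc, Finset.sum_mul_sum]
  simpa only [← sq] using key

lemma trace_sq_nonneg {h T : Mat3} (hh : h.PosSemidef) (hT : Tᵀ = T) :
    0 ≤ trace (h * T * (h * T)) := by
  obtain ⟨B, rfl⟩ := exists_eq_transpose_mul_self hh
  have : trace (Bᵀ * B * T * (Bᵀ * B * T)) = trace ((B * T * Bᵀ)ᵀ * (B * T * Bᵀ)) := by
    rw [show Bᵀ * B * T * (Bᵀ * B * T) = Bᵀ * (B * T * Bᵀ * (B * T)) by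
      simp only [Matrix.mul_assoc], trace_mul_comm]
    congr 1
    simp [Matrix.mul_assoc, hT]
  rw [this, ← conjTranspose_eq_transpose_of_trivial]
  exact (Matrix.posSemidef_conjTranspose_mul_self _).trace_nonneg

/-! ### Evolution equations -/

section MatrixDeriv

variable {A B : ℝ → Mat3} {A' B' : Mat3} {S : Set ℝ} {t : ℝ}

lemma hasDerivWithinAt_mul_entry
    (hA : ∀ a b, HasDerivWithinAt (fun s => A s a b) (A' a b) S t)
    (hB : ∀ a b, HasDerivWithinAt (fun s => B s a b) (B' a b) S t) (a b : Fin 3) :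
    HasDerivWithinAt (fun s => (A s * B s) a b) ((A' * B t + A t * B') a b) S t := by
  simp only [Matrix.add_apply, Matrix.mul_apply, ← Finset.sum_add_distrib]
  exact HasDerivWithinAt.fun_sum fun c _ => (hA a c).fun_mul (hB c b)

lemma hasDerivWithinAt_trace (hA : ∀ a b, HasDerivWithinAt (fun s => A s a b) (A' a b) S t) :
    HasDerivWithinAt (fun s => trace (A s)) (trace A') S t := by
  simp only [trace, diag]
  exact HasDerivWithinAt.fun_sum fun c _ => hA c c

lemma hasDerivWithinAt_dotProduct_mulVec
    (hA : ∀ a b, HasDerivWithinAt (fun s => A s a b) (A' a b) S t) (p r : Mom) :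
    HasDerivWithinAt (fun s => p ⬝ᵥ A s *ᵥ r) (p ⬝ᵥ A' *ᵥ r) S t := by
  simp only [dotProduct, mulVec]
  exact HasDerivWithinAt.fun_sum fun c _ => HasDerivWithinAt.const_mul _
    (HasDerivWithinAt.fun_sum fun d _ => (hA c d).mul_const _)

lemma differentiableWithinAt_inv_entry
    (hA : ∀ a b, DifferentiableWithinAt ℝ (fun s => A s a b) S t) (ht : (A t).det ≠ 0)
    (a b : Fin 3) : DifferentiableWithinAt ℝ (fun s => (A s)⁻¹ a b) S t := by
  have hdet : DifferentiableWithinAt ℝ (fun s => (A s).det) S t := by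
    simp only [Matrix.det_fin_three]
    fun_prop
  have hadj : DifferentiableWithinAt ℝ (fun s => (A s).adjugate a b) S t := by
    simp only [Matrix.adjugate_fin_three]
    fin_cases a <;> fin_cases b <;> simp <;> fun_prop
  have : (fun s => (A s)⁻¹ a b) = fun s => (A s).det⁻¹ * (A s).adjugate a b := by
    funext s
    simp [Matrix.inv_def]
  rw [this]
  exact (hdet.fun_inv ht).fun_mul hadj

/-- Adjugate over determinant gives differentiability; the value is then forced by differentiating A
A⁻¹ = 1. -/
lemma hasDerivWithinAt_inv_entry (hS : UniqueDiffWithinAt ℝ S t)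
    (htS : t ∈ S) (hu : ∀ s ∈ S, IsUnit (A s).det)
    (hA : ∀ a b, HasDerivWithinAt (fun s => A s a b) (A' a b) S t) (a b : Fin 3) :
    HasDerivWithinAt (fun s => (A s)⁻¹ a b) ((-((A t)⁻¹ * A' * (A t)⁻¹)) a b) S t := by
  set D : Mat3 := fun a b => derivWithin (fun s => (A s)⁻¹ a b) S t with hD
  have hd : ∀ a b, HasDerivWithinAt (fun s => (A s)⁻¹ a b) (D a b) S t := fun a b =>
    (differentiableWithinAt_inv_entry (fun a b => (hA a b).differentiableWithinAt)
      (hu t htS).ne_zero a b).hasDerivWithinAt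
  have h0 : A' * (A t)⁻¹ + A t * D = 0 := by
    ext a b
    have h1 := hasDerivWithinAt_mul_entry hA hd a b
    have h2 : HasDerivWithinAt (fun s => (A s * (A s)⁻¹) a b) 0 S t :=
      (hasDerivWithinAt_const t S ((1 : Mat3) a b)).congr_of_mem
        (fun s hs => by rw [mul_nonsing_inv _ (hu s hs)]) htS
    exact hS.eq_deriv _ h1 h2
  have h3 : D = -((A t)⁻¹ * A' * (A t)⁻¹) := by
    have : (A t)⁻¹ * (A' * (A t)⁻¹ + A t * D) = 0 := by rw [h0, mul_zero]
    rw [mul_add, ← mul_assoc, ← mul_assoc, nonsing_inv_mul _ (hu t htS), one_mul] at this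
    exact (neg_eq_of_add_eq_zero_right this).symm
  rw [← h3]
  exact hd a b

end MatrixDeriv

/-- `σ_{ab} σ^{ab}`. -/
noncomputable def shearSq (g k : Mat3) : ℝ := trace (g⁻¹ * shear g k * (g⁻¹ * shear g k))

lemma momSq_eq (g : Mat3) (p : Mom) : momSq g p = p ⬝ᵥ g⁻¹ *ᵥ p := by
  simp only [momSq, dotProduct, mulVec, Finset.mul_sum]
  exact Finset.sum_congr rfl fun a _ => Finset.sum_congr rfl fun b _ => by ring

lemma momSq_nonneg {g : Mat3} (hg : g.PosDef) (p : Mom) : 0 ≤ momSq g p := by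
  have := hg.inv.posSemidef.dotProduct_mulVec_nonneg p
  rwa [star_trivial, ← momSq_eq] at this

lemma stress_transpose (g : Mat3) (f : Mom → ℝ) : (stress g f)ᵀ = stress g f := by
  ext a b
  simp only [transpose_apply, stress]
  congr 2
  funext p
  ring

lemma shear_eq (g k : Mat3) : shear g k = k + hubble g k • g := by
  ext a b
  simp [shear]

lemma shear_transpose {g k : Mat3} (hg : g.PosDef) (hk : kᵀ = k) : (shear g k)ᵀ = shear g k := by
  rw [shear_eq, transpose_add, transpose_smul, hk, transpose_eq_of_posDef hg]

lemma inv_mul_shear {g : Mat3} (hg : g.PosDef) (k : Mat3) :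
    g⁻¹ * shear g k = g⁻¹ * k + hubble g k • (1 : Mat3) := by
  rw [shear_eq, Matrix.mul_add, Matrix.mul_smul, inv_mul_of_posDef hg]

lemma trace_inv_mul {g k : Mat3} (hk : kᵀ = k) : trace (g⁻¹ * k) = -3 * hubble g k := by
  rw [hubble, tr_eq_trace g k hk]
  ring

lemma shearSq_eq {g k : Mat3} (hg : g.PosDef) (hk : kᵀ = k) :
    shearSq g k = trace (g⁻¹ * k * (g⁻¹ * k)) - 3 * hubble g k ^ 2 := by
  have h := trace_inv_mul (g := g) hk
  simp only [shearSq, inv_mul_shear hg, add_mul, mul_add, trace_add, mul_one, one_mul, smul_mul_assoc,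
    mul_smul_comm, trace_smul, trace_one, smul_eq_mul, Fintype.card_fin]
  rw [h]
  push_cast
  ring

lemma shearSq_nonneg {g k : Mat3} (hg : g.PosDef) (hk : kᵀ = k) : 0 ≤ shearSq g k :=
  trace_sq_nonneg hg.inv.posSemidef (shear_transpose hg hk)

/-! ### The Einstein equations in terms of expansion and shear. -/

namespace IsSolution

variable {t₀ t : ℝ} {g k : ℝ → Mat3} {f : ℝ → Mom → ℝ}

/-- The derivative -2k of the symmetric g is symmetric, by uniqueness of one-sided derivatives on
`Ici t₀`. -/
lemma second_transpose (sol : IsSolution t₀ g k f) (ht : t₀ ≤ t) : (k t)ᵀ = k t := by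
  ext a b
  have h1 := sol.metric_evol t ht a b
  have h2 := (sol.metric_evol t ht b a).congr_of_mem
    (fun s hs => symm_of_posDef (sol.metric_posDef s hs) a b) ht
  have := (uniqueDiffOn_Ici t₀ t ht).eq_deriv _ h1 h2
  rw [transpose_apply]
  linarith

lemma hasDeriv_inv (sol : IsSolution t₀ g k f) (ht : t₀ ≤ t) (a b : Fin 3) :
    HasDerivWithinAt (fun s => (g s)⁻¹ a b)
      (((2 : ℝ) • ((g t)⁻¹ * shear (g t) (k t) * (g t)⁻¹)
        - (2 * hubble (g t) (k t)) • (g t)⁻¹) a b) (Ici t₀) t := by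
  have hg := sol.metric_posDef t ht
  have := hasDerivWithinAt_inv_entry (A := g) (A' := (-2 : ℝ) • k t) (uniqueDiffOn_Ici t₀ t ht) ht
    (fun s hs => isUnit_det_of_posDef (sol.metric_posDef s hs))
    (fun a b => by simpa using sol.metric_evol t ht a b) a b
  convert this using 1
  refine congrFun (congrFun ?_ a) b
  rw [inv_mul_shear hg]
  simp only [Matrix.mul_smul, Matrix.smul_mul, Matrix.add_mul, Matrix.one_mul]
  ext i j
  simp only [Matrix.add_apply, Matrix.sub_apply, Matrix.neg_apply, Matrix.smul_apply, smul_eq_mul]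
  ring

lemma hasDeriv_momSq (sol : IsSolution t₀ g k f) (ht : t₀ ≤ t) (p : Mom) :
    HasDerivWithinAt (fun s => momSq (g s) p)
      (2 * (p ⬝ᵥ ((g t)⁻¹ * shear (g t) (k t) * (g t)⁻¹) *ᵥ p)
        - 2 * hubble (g t) (k t) * momSq (g t) p) (Ici t₀) t := by
  have := hasDerivWithinAt_dotProduct_mulVec (sol.hasDeriv_inv ht) p p
  simp only [momSq_eq]
  convert this using 1
  simp only [sub_mulVec, smul_mulVec, dotProduct_sub, dotProduct_smul, smul_eq_mul]

lemma hasDeriv_metric (sol : IsSolution t₀ g k f) (ht : t₀ ≤ t) (a b : Fin 3) :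
    HasDerivWithinAt (fun s => g s a b)
      (2 * hubble (g t) (k t) * g t a b - 2 * shear (g t) (k t) a b) (Ici t₀) t := by
  convert sol.metric_evol t ht a b using 1
  rw [shear]
  ring

lemma hamiltonian_eq (sol : IsSolution t₀ g k f) (ht : t₀ ≤ t) :
    6 * hubble (g t) (k t) ^ 2 =
      shearSq (g t) (k t) + 6 * (g t)⁻¹ 0 0 + 16 * Real.pi * rho (g t) (f t) := by
  have hg := sol.metric_posDef t ht
  have hk := sol.second_transpose ht
  have h := sol.hamiltonian t ht
  rw [scalarCurv_eq hg, normSq_eq_trace hg _ hk, tr_eq_trace _ _ hk, trace_inv_mul hk] at h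
  rw [shearSq_eq hg hk]
  linarith

/-- The Einstein evolution equation for `k^a_b`. -/
lemma hasDeriv_mixed (sol : IsSolution t₀ g k f) (ht : t₀ ≤ t) (a b : Fin 3) :
    HasDerivWithinAt (fun s => ((g s)⁻¹ * k s) a b)
      (((-3 * hubble (g t) (k t)) • ((g t)⁻¹ * k t)
        - (8 * Real.pi) • ((g t)⁻¹ * stress (g t) (f t))
        + (-2 * (g t)⁻¹ 0 0 + 4 * Real.pi * tr (g t) (stress (g t) (f t))
            - 4 * Real.pi * rho (g t) (f t)) • (1 : Mat3)) a b) (Ici t₀) t := by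
  have hg := sol.metric_posDef t ht
  have hk := sol.second_transpose ht
  have hgi := inv_mul_of_posDef hg
  have hκ : tr (g t) (k t) = -3 * hubble (g t) (k t) := by
    rw [tr_eq_trace _ _ hk, trace_inv_mul hk]
  -- The term -2 k g⁻¹ k cancels against the derivative of g⁻¹, and the Ricci tensor, a multiple of
  -- g, contributes only to the multiple of the identity.
  have h1 := hasDerivWithinAt_mul_entry
    (B' := (-2 * (g t)⁻¹ 0 0) • g t + (-3 * hubble (g t) (k t)) • k t
      - (2 : ℝ) • (k t * ((g t)⁻¹ * k t))
      - (8 * Real.pi) • (stress (g t) (f t) - (1 / 2 * tr (g t) (stress (g t) (f t))) • g t)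
      - (4 * Real.pi * rho (g t) (f t)) • g t)
    (sol.hasDeriv_inv ht) (fun a b => by
      convert sol.second_evol t ht a b using 1
      simp only [Matrix.sub_apply, Matrix.add_apply, Matrix.smul_apply, smul_eq_mul, ricci_eq hg,
        hκ, mixed_eq, Matrix.mul_apply (M := k t)]
      ring) a b
  convert h1 using 1
  refine congrFun (congrFun ?_ a) b
  rw [inv_mul_shear hg]
  simp only [Matrix.mul_add, Matrix.mul_sub, Matrix.add_mul, Matrix.sub_mul, Matrix.mul_smul,
    Matrix.smul_mul, hgi, Matrix.one_mul, Matrix.mul_assoc]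
  ext i j
  simp only [Matrix.add_apply, Matrix.sub_apply, Matrix.smul_apply, smul_eq_mul]
  ring

/-- The Raychaudhuri equation: the trace of `hasDeriv_mixed`, with the curvature eliminated by the
Hamiltonian constraint. Every term beyond -H² is nonpositive. -/
lemma hasDeriv_hubble (sol : IsSolution t₀ g k f) (ht : t₀ ≤ t) :
    HasDerivWithinAt (fun s => hubble (g s) (k s))
      (-hubble (g t) (k t) ^ 2 - shearSq (g t) (k t) / 3
        - 4 * Real.pi / 3 * (tr (g t) (stress (g t) (f t)) + rho (g t) (f t))) (Ici t₀) t := by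
  have hk := sol.second_transpose ht
  have h1 := (hasDerivWithinAt_trace (sol.hasDeriv_mixed ht)).const_mul (-(1 / 3) : ℝ)
  have h2 : HasDerivWithinAt (fun s => hubble (g s) (k s)) _ (Ici t₀) t :=
    h1.congr_of_mem (fun s hs => by
      rw [hubble, tr_eq_trace _ _ (sol.second_transpose hs)]) ht
  convert h2 using 1
  have h3 := sol.hamiltonian_eq ht
  simp only [trace_add, trace_sub, trace_smul, trace_one, smul_eq_mul, Fintype.card_fin,
    trace_inv_mul hk, tr_eq_trace _ _ (stress_transpose (g t) (f t))]
  push_cast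
  linear_combination (1 / 3) * h3

/-- Obtained by differentiating |σ|² = tr (g⁻¹k)² - 3H². By the Hamiltonian constraint all
pure-trace contributions cancel, so no curvature term drives the shear. -/
lemma hasDeriv_shearSq (sol : IsSolution t₀ g k f) (ht : t₀ ≤ t) :
    HasDerivWithinAt (fun s => shearSq (g s) (k s))
      (-6 * hubble (g t) (k t) * shearSq (g t) (k t) - 16 * Real.pi *
        trace ((g t)⁻¹ * shear (g t) (k t) * ((g t)⁻¹ * stress (g t) (f t)))) (Ici t₀) t := by
  have hg := sol.metric_posDef t ht
  have hk := sol.second_transpose ht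
  have h1 := hasDerivWithinAt_trace
    (hasDerivWithinAt_mul_entry (sol.hasDeriv_mixed ht) (sol.hasDeriv_mixed ht))
  have h2 : HasDerivWithinAt (fun s => shearSq (g s) (k s)) _ (Ici t₀) t :=
    (h1.fun_sub (((sol.hasDeriv_hubble ht).fun_pow 2).const_mul 3)).congr_of_mem (fun s hs => by
      rw [shearSq_eq (sol.metric_posDef s hs) (sol.second_transpose hs)]) ht
  convert h2 using 1
  have h3 := sol.hamiltonian_eq ht
  rw [shearSq_eq hg hk] at h3 ⊢
  rw [trace_add, trace_mul_comm (_ + _)]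
  simp only [inv_mul_shear hg, Matrix.add_mul, Matrix.mul_add, Matrix.mul_sub, trace_add, trace_sub,
    Matrix.mul_one, Matrix.one_mul, Matrix.smul_mul, Matrix.mul_smul, trace_smul, smul_eq_mul, trace_inv_mul hk,
    tr_eq_trace _ _ (stress_transpose (g t) (f t))]
  push_cast
  linear_combination (2 * hubble (g t) (k t)) * h3

/-- The momentum constraint determines the zeroth row of σ^a_b by the current. This removes the
shear from the derivative of `g⁻¹ 0 0`, hence from that of the scalar curvature. -/
lemma shear_upper_zero (sol : IsSolution t₀ g k f) (ht : t₀ ≤ t) :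
    ((g t)⁻¹ * shear (g t) (k t) * (g t)⁻¹) 0 0 =
      -(8 * Real.pi / 3) * ∑ b, (g t)⁻¹ 0 b * current (g t) (f t) b := by
  have hg := sol.metric_posDef t ht
  have hk := sol.second_transpose ht
  have h : ∀ b, ((g t)⁻¹ * shear (g t) (k t)) 0 b = -(8 * Real.pi / 3) * current (g t) (f t) b := by
    intro b
    have h1 := sol.momentum t ht b
    rw [diverg_eq hg _ hk, tr_eq_trace _ _ hk, trace_inv_mul hk] at h1
    rw [inv_mul_shear hg, Matrix.add_apply, Matrix.smul_apply, smul_eq_mul,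
      show (1 : Mat3) 0 b = aVec b by fin_cases b <;> simp [aVec, Matrix.one_apply]]
    linear_combination (-1 / 3) * h1
  rw [Matrix.mul_apply, Finset.mul_sum]
  refine Finset.sum_congr rfl fun b _ => ?_
  rw [h, inv_symm hg b 0]
  ring

end IsSolution

/-! ### Matter estimates -/

section Matter

open MeasureTheory

variable {g : Mat3} {f : Mom → ℝ}

lemma continuous_momSq (g : Mat3) : Continuous (momSq g) := by
  unfold momSq
  fun_prop

lemma continuous_pZero (g : Mat3) : Continuous (pZero g) :=
  Real.continuous_sqrt.comp (continuous_const.add (continuous_momSq g))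

lemma one_le_pZero (hg : g.PosDef) (p : Mom) : 1 ≤ pZero g p := by
  have := momSq_nonneg hg p
  exact Real.one_le_sqrt.2 (by linarith)

lemma pZero_pos (hg : g.PosDef) (p : Mom) : 0 < pZero g p :=
  lt_of_lt_of_le one_pos (one_le_pZero hg p)

lemma integrable_mul_of_density (hc : Continuous f) (hs : HasCompactSupport f) {φ : Mom → ℝ}
    (hφ : Continuous φ) : Integrable fun p => f p * φ p :=
  (hc.mul hφ).integrable_of_hasCompactSupport hs.mul_right

lemma sum_mul_stress (hg : g.PosDef) (hc : Continuous f) (hs : HasCompactSupport f) (M : Mat3) :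
    ∑ a, ∑ b, M a b * stress g f a b =
      (Real.sqrt g.det)⁻¹ * ∫ p, f p * ((p ⬝ᵥ M *ᵥ p) / pZero g p) := by
  have hp : ∀ p, pZero g p ≠ 0 := fun p => (pZero_pos hg p).ne'
  have hint : ∀ a b, Integrable fun p : Mom => f p * (M a b * (p a * p b / pZero g p)) :=
    fun a b => integrable_mul_of_density hc hs (continuous_const.mul
      (((continuous_apply a).mul (continuous_apply b)).div (continuous_pZero g) hp))
  have h1 : ∀ a b, M a b * stress g f a b =
      (Real.sqrt g.det)⁻¹ * ∫ p, f p * (M a b * (p a * p b / pZero g p)) := by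
    intro a b
    rw [stress, mul_left_comm, ← integral_const_mul]
    congr 2
    funext p
    ring
  simp only [h1, ← Finset.mul_sum]
  congr 1
  have h2 : ∀ a, ∑ b, ∫ p, f p * (M a b * (p a * p b / pZero g p)) =
      ∫ p, ∑ b, f p * (M a b * (p a * p b / pZero g p)) := fun a =>
    (integral_finsetSum _ fun b _ => hint a b).symm
  simp only [h2]
  rw [← integral_finsetSum _ fun a _ => integrable_finsetSum _ fun b _ => hint a b]
  congr 1
  funext p
  simp only [dotProduct, mulVec, Finset.mul_sum, Finset.sum_div]
  exact Finset.sum_congr rfl fun a _ => Finset.sum_congr rfl fun b _ => by ring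

lemma tr_stress_eq (hg : g.PosDef) (hc : Continuous f) (hs : HasCompactSupport f) :
    tr g (stress g f) = (Real.sqrt g.det)⁻¹ * ∫ p, f p * (momSq g p / pZero g p) := by
  simp only [tr, sum_mul_stress hg hc hs, momSq_eq]

lemma rho_nonneg (hf : ∀ p, 0 ≤ f p) : 0 ≤ rho g f :=
  mul_nonneg (inv_nonneg.2 (Real.sqrt_nonneg _))
    (integral_nonneg fun p => mul_nonneg (hf p) (Real.sqrt_nonneg _))

lemma tr_stress_nonneg (hg : g.PosDef) (hc : Continuous f) (hs : HasCompactSupport f)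
    (hf : ∀ p, 0 ≤ f p) : 0 ≤ tr g (stress g f) := by
  rw [tr_stress_eq hg hc hs]
  exact mul_nonneg (inv_nonneg.2 (Real.sqrt_nonneg _)) (integral_nonneg fun p =>
    mul_nonneg (hf p) (div_nonneg (momSq_nonneg hg p) (Real.sqrt_nonneg _)))

/-- On the support |p|²/p⁰ ≤ Q p⁰ because p⁰ ≥ 1: slow matter has stress much smaller than its
density. -/
lemma tr_stress_le (hg : g.PosDef) (hc : Continuous f) (hs : HasCompactSupport f)
    (hf : ∀ p, 0 ≤ f p) {Q : ℝ} (hQ : 0 ≤ Q) (hP : ∀ p, f p ≠ 0 → momSq g p ≤ Q) :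
    tr g (stress g f) ≤ Q * rho g f := by
  rw [tr_stress_eq hg hc hs, rho, mul_left_comm, ← integral_const_mul Q]
  refine mul_le_mul_of_nonneg_left ?_ (inv_nonneg.2 (Real.sqrt_nonneg _))
  refine integral_mono (integrable_mul_of_density hc hs ((continuous_momSq g).div
    (continuous_pZero g) fun p => (pZero_pos hg p).ne'))
    ((integrable_mul_of_density hc hs (continuous_pZero g)).const_mul Q) fun p => ?_
  by_cases h : f p = 0
  · simp [h]
  have h1 := one_le_pZero hg p
  have h2 : momSq g p / pZero g p ≤ Q * pZero g p := by
    rw [div_le_iff₀ (pZero_pos hg p)]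
    nlinarith [hP p h, mul_nonneg hQ (sub_nonneg.2 h1), mul_nonneg hQ (sq_nonneg (pZero g p - 1))]
  calc f p * (momSq g p / pZero g p) ≤ f p * (Q * pZero g p) :=
        mul_le_mul_of_nonneg_left h2 (hf p)
    _ = Q * (f p * pZero g p) := by ring

/-- The stress is a positive superposition of the tensors p ⊗ p, and |σ^{ab} p_a p_b| ≤ |σ| |p|² for
each of them. -/
lemma abs_trace_shear_stress_le {k : Mat3} (hg : g.PosDef) (hk : kᵀ = k) (hc : Continuous f)
    (hs : HasCompactSupport f) (hf : ∀ p, 0 ≤ f p) :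
    |trace (g⁻¹ * shear g k * (g⁻¹ * stress g f))| ≤
      Real.sqrt (shearSq g k) * tr g (stress g f) := by
  have h1 : trace (g⁻¹ * shear g k * (g⁻¹ * stress g f)) =
      ∑ a, ∑ b, (g⁻¹ * shear g k * g⁻¹) a b * stress g f a b := by
    rw [← Matrix.mul_assoc]
    simp only [trace, diag, Matrix.mul_apply (N := stress g f)]
    exact Finset.sum_congr rfl fun a _ => Finset.sum_congr rfl fun b _ => by
      rw [show stress g f b a = stress g f a b from congrFun (congrFun (stress_transpose g f) a) b]
  rw [h1, sum_mul_stress hg hc hs, tr_stress_eq hg hc hs, abs_mul,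
    abs_of_nonneg (inv_nonneg.2 (Real.sqrt_nonneg _)), mul_left_comm, ← integral_const_mul]
  refine mul_le_mul_of_nonneg_left ?_ (inv_nonneg.2 (Real.sqrt_nonneg _))
  rw [← Real.norm_eq_abs]
  refine norm_integral_le_of_norm_le ((integrable_mul_of_density hc hs ((continuous_momSq g).div
    (continuous_pZero g) fun p => (pZero_pos hg p).ne')).const_mul _)
    (Eventually.of_forall fun p => ?_)
  have h2 := contract_sq_le hg.inv.posSemidef (shear_transpose hg hk) p p
  rw [← momSq_eq, ← shearSq, mul_assoc (shearSq g k), ← sq] at h2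
  have h3 := Real.abs_le_sqrt h2
  rw [Real.sqrt_mul (shearSq_nonneg hg hk), Real.sqrt_sq (momSq_nonneg hg p)] at h3
  rw [Real.norm_eq_abs, abs_mul, abs_div, abs_of_nonneg (hf p), abs_of_pos (pZero_pos hg p)]
  calc f p * (|p ⬝ᵥ (g⁻¹ * shear g k * g⁻¹) *ᵥ p| / pZero g p)
      ≤ f p * (Real.sqrt (shearSq g k) * momSq g p / pZero g p) :=
        mul_le_mul_of_nonneg_left (div_le_div_of_nonneg_right h3 (pZero_pos hg p).le) (hf p)
    _ = Real.sqrt (shearSq g k) * (f p * (momSq g p / pZero g p)) := by ring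

lemma sq_momUp_zero_le (hg : g.PosDef) (p : Mom) :
    (momUp g p 0) ^ 2 ≤ g⁻¹ 0 0 * momSq g p := by
  have h1 : momUp g p 0 = (Pi.single 0 1 : Mom) ⬝ᵥ g⁻¹ *ᵥ p := by
    rw [single_one_dotProduct]
    rfl
  have h2 : g⁻¹ 0 0 = (Pi.single 0 1 : Mom) ⬝ᵥ g⁻¹ *ᵥ Pi.single 0 1 := by
    rw [single_one_dotProduct, mulVec_single_one]
    rfl
  rw [h1, h2, momSq_eq]
  exact sq_dotProduct_mulVec_le hg.inv.posSemidef _ _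

lemma abs_current_upper_zero_le (hg : g.PosDef) (hc : Continuous f) (hs : HasCompactSupport f)
    (hf : ∀ p, 0 ≤ f p) {Q : ℝ} (hP : ∀ p, f p ≠ 0 → momSq g p ≤ Q) :
    |∑ b, g⁻¹ 0 b * current g f b| ≤ Real.sqrt (g⁻¹ 0 0 * Q) * rho g f := by
  have h1 : ∑ b, g⁻¹ 0 b * current g f b =
      (Real.sqrt g.det)⁻¹ * ∫ p, f p * momUp g p 0 := by
    have hint : ∀ b, Integrable fun p : Mom => f p * (g⁻¹ 0 b * p b) := fun b =>
      integrable_mul_of_density hc hs (continuous_const.mul (continuous_apply b))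
    simp only [momUp, Finset.mul_sum]
    rw [integral_finsetSum _ fun b _ => hint b, Finset.mul_sum]
    refine Finset.sum_congr rfl fun b _ => ?_
    rw [current, mul_left_comm, ← integral_const_mul]
    congr 2
    funext p
    ring
  rw [h1, rho, abs_mul, abs_of_nonneg (inv_nonneg.2 (Real.sqrt_nonneg _)), mul_left_comm,
    ← integral_const_mul]
  refine mul_le_mul_of_nonneg_left ?_ (inv_nonneg.2 (Real.sqrt_nonneg _))
  rw [← Real.norm_eq_abs]
  refine norm_integral_le_of_norm_le ((integrable_mul_of_density hc hs
    (continuous_pZero g)).const_mul _) (Eventually.of_forall fun p => ?_)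
  rw [Real.norm_eq_abs, abs_mul, abs_of_nonneg (hf p)]
  by_cases h : f p = 0
  · simp [h]
  have h2 : |momUp g p 0| ≤ Real.sqrt (g⁻¹ 0 0 * Q) := Real.abs_le_sqrt
    ((sq_momUp_zero_le hg p).trans
      (mul_le_mul_of_nonneg_left (hP p h) hg.inv.posSemidef.diag_nonneg))
  calc f p * |momUp g p 0| ≤ f p * (Real.sqrt (g⁻¹ 0 0 * Q) * pZero g p) :=
        mul_le_mul_of_nonneg_left (h2.trans
          (le_mul_of_one_le_right (Real.sqrt_nonneg _) (one_le_pZero hg p))) (hf p)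
    _ = Real.sqrt (g⁻¹ 0 0 * Q) * (f p * pZero g p) := by ring

/-- Compact support bounds the set of momenta, so the supremum is a genuine one and not the default
value of `sSup`. -/
lemma sqrt_momSq_le_maxMom (hs : HasCompactSupport f) {p : Mom} (hp : f p ≠ 0) :
    Real.sqrt (momSq g p) ≤ maxMom g f := by
  refine le_csSup ?_ ⟨p, hp, rfl⟩
  have := (hs.isCompact.image (Real.continuous_sqrt.comp (continuous_momSq g))).bddAbove
  refine this.mono ?_
  rintro r ⟨p, hp, rfl⟩
  exact ⟨p, subset_tsupport f hp, rfl⟩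

lemma maxMom_nonneg (g : Mat3) (f : Mom → ℝ) : 0 ≤ maxMom g f :=
  Real.sSup_nonneg (by rintro r ⟨p, -, rfl⟩; exact Real.sqrt_nonneg _)

lemma maxMom_le {Q : ℝ} (hP : ∀ p, f p ≠ 0 → momSq g p ≤ Q) : maxMom g f ≤ Real.sqrt Q :=
  Real.sSup_le (by rintro r ⟨p, hp, rfl⟩; exact Real.sqrt_le_sqrt (hP p hp)) (Real.sqrt_nonneg _)

end Matter

/-! ### Propagation of the momentum support -/

open Topology in
lemma nonneg_of_hasDerivAt_of_le_left {w : ℝ → ℝ} {w' τ : ℝ} (hw : HasDerivAt w w' τ)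
    (hle : ∀ᶠ s in 𝓝[<] τ, w s ≤ w τ) : 0 ≤ w' := by
  have h1 := (hasDerivWithinAt_iff_tendsto_slope' (s := Iio τ) (by simp)).1 hw.hasDerivWithinAt
  refine ge_of_tendsto h1 ?_
  filter_upwards [hle, self_mem_nhdsWithin] with s hs hlt
  rw [slope_def_field]
  exact div_nonneg_of_nonpos (sub_nonpos.2 hs) (sub_nonpos.2 (le_of_lt hlt))

open Topology in
/-- A maximum principle for solutions `f ≥ 0` of a transport equation with the vector field `V`:
if `m` does not increase and `n` does not decrease along `V`, the support of `f` stays in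
`{m ≤ M}`. -/
lemma transport_support {t₀ T M N : ℝ} {f m n m' n' : ℝ → Mom → ℝ} {V : ℝ → Mom → Mom}
    {K : Set Mom} (hK : IsCompact K)
    (hfc : ContinuousOn (fun q : ℝ × Mom => f q.1 q.2) (Icc t₀ T ×ˢ univ))
    (hmc : ContinuousOn (fun q : ℝ × Mom => m q.1 q.2) (Icc t₀ T ×ˢ univ))
    (hnc : ContinuousOn (fun q : ℝ × Mom => n q.1 q.2) (Icc t₀ T ×ˢ univ))
    (hnK : ∀ t ∈ Icc t₀ T, ∀ p, n t p ≤ N → p ∈ K)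
    (hf : ∀ t ∈ Icc t₀ T, ∀ p, 0 ≤ f t p)
    (hfd : ∀ t ∈ Ioc t₀ T, Differentiable ℝ (f t))
    (hmd : ∀ t ∈ Ioc t₀ T, Differentiable ℝ (m t))
    (hnd : ∀ t ∈ Ioc t₀ T, Differentiable ℝ (n t))
    (hmV : ∀ t ∈ Ioc t₀ T, ∀ p, fderiv ℝ (m t) p (V t p) = 0)
    (hnV : ∀ t ∈ Ioc t₀ T, ∀ p, fderiv ℝ (n t) p (V t p) = 0)
    (hft : ∀ t ∈ Ioc t₀ T, ∀ p, HasDerivAt (fun s => f s p) (-fderiv ℝ (f t) p (V t p)) t)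
    (hmt : ∀ t ∈ Ioc t₀ T, ∀ p, HasDerivAt (fun s => m s p) (m' t p) t)
    (hnt : ∀ t ∈ Ioc t₀ T, ∀ p, HasDerivAt (fun s => n s p) (n' t p) t)
    (hm' : ∀ t ∈ Ioc t₀ T, ∀ p, m' t p ≤ 0)
    (hn' : ∀ t ∈ Ioc t₀ T, ∀ p, 0 ≤ n' t p)
    (hinit : ∀ p, f t₀ p ≠ 0 → m t₀ p ≤ M) :
    ∀ t ∈ Icc t₀ T, ∀ p, n t p < N → f t p ≠ 0 → m t p ≤ M := by
  intro t₁ ht₁ p₁ hn₁ hf₁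
  by_contra! hm₁
  -- `u` vanishes where f = 0, m = M or n = N, so a positive maximum over the compact set {m ≥ M, n
  -- ≤ N} avoids these boundaries. The factor N - n is a cutoff that supplies the compactness.
  set u : ℝ × Mom → ℝ := fun q => f q.1 q.2 * (m q.1 q.2 - M) * (N - n q.1 q.2) with hu
  have hu₁ : 0 < u (t₁, p₁) := mul_pos (mul_pos (lt_of_le_of_ne (hf t₁ ht₁ p₁) hf₁.symm)
    (sub_pos.2 hm₁)) (sub_pos.2 hn₁)
  -- The slope is positive, so that the penalty makes the time derivative strictly negative at the
  -- maximum, yet small enough that `w` is still positive at (t₁, p₁). The `+ 1` covers t₁ = t₀.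
  set e : ℝ := u (t₁, p₁) / (t₁ - t₀ + 1) with he
  have hpos : 0 < t₁ - t₀ + 1 := by linarith [ht₁.1]
  have he0 : 0 < e := div_pos hu₁ hpos
  set w : ℝ × Mom → ℝ := fun q => u q - e * (q.1 - t₀) with hw
  have hw₁ : 0 < w (t₁, p₁) := by
    have : e * (t₁ - t₀ + 1) = u (t₁, p₁) := div_mul_cancel₀ _ hpos.ne'
    simp only [hw]
    linarith
  set D : Set (ℝ × Mom) := (Icc t₀ T ×ˢ K) ∩
    (fun q : ℝ × Mom => (m q.1 q.2, n q.1 q.2)) ⁻¹' (Ici M ×ˢ Iic N) with hD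
  have hsub : Icc t₀ T ×ˢ K ⊆ Icc t₀ T ×ˢ (univ : Set Mom) := prod_mono_right (subset_univ _)
  have hDc : IsCompact D := by
    have h1 : IsClosed (Icc t₀ T ×ˢ K) := (isCompact_Icc.prod hK).isClosed
    exact (isCompact_Icc.prod hK).of_isClosed_subset
      (((hmc.prodMk hnc).mono hsub).preimage_isClosed_of_isClosed h1
        (isClosed_Ici.prod isClosed_Iic)) inter_subset_left
  have hwc : ContinuousOn w D := by
    have : ContinuousOn w (Icc t₀ T ×ˢ univ) :=
      ((hfc.mul (hmc.sub continuousOn_const)).mul (continuousOn_const.sub hnc)).sub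
        (continuousOn_const.mul (continuousOn_fst.sub continuousOn_const))
    exact this.mono (inter_subset_left.trans hsub)
  have hmemD : ∀ t ∈ Icc t₀ T, ∀ p, M ≤ m t p → n t p ≤ N → (t, p) ∈ D := fun t ht p h1 h2 =>
    ⟨⟨ht, hnK t ht p h2⟩, h1, h2⟩
  obtain ⟨⟨τ, π⟩, hqD, hmax⟩ := hDc.exists_isMaxOn
    ⟨_, hmemD t₁ ht₁ p₁ hm₁.le hn₁.le⟩ hwc
  have hτ : τ ∈ Icc t₀ T := hqD.1.1
  have hmτ : M ≤ m τ π := hqD.2.1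
  have hnτ : n τ π ≤ N := hqD.2.2
  have hwq : 0 < w (τ, π) := hw₁.trans_le (hmax (hmemD t₁ ht₁ p₁ hm₁.le hn₁.le))
  have huq : 0 < u (τ, π) := by
    have : 0 ≤ e * (τ - t₀) := mul_nonneg he0.le (sub_nonneg.2 hτ.1)
    simp only [hw] at hwq
    linarith
  have hf0 : f τ π ≠ 0 := by
    intro h
    simp [hu, h] at huq
  have hm0 : M < m τ π := by
    refine lt_of_le_of_ne hmτ fun h => ?_
    simp [hu, ← h] at huq
  have hn0 : n τ π < N := by
    refine lt_of_le_of_ne hnτ fun h => ?_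
    simp [hu, h] at huq
  have hτ' : τ ∈ Ioc t₀ T := by
    refine ⟨lt_of_le_of_ne hτ.1 fun h => ?_, hτ.2⟩
    subst h
    exact absurd (hinit π hf0) (not_le.2 hm0)
  -- At the maximum the derivative of `u` along V vanishes. As m and n are constant along V, this
  -- leaves V f = 0, so ∂ₜf = 0 there.
  have hfV : fderiv ℝ (f τ) π (V τ π) = 0 := by
    have hloc : IsLocalMax (fun p => u (τ, p)) π := by
      have h1 : ∀ᶠ p in 𝓝 π, M < m τ p := (hmd τ hτ').continuous.continuousAt.eventually_const_lt hm0
      have h2 : ∀ᶠ p in 𝓝 π, n τ p < N := (hnd τ hτ').continuous.continuousAt.eventually_lt_const hn0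
      filter_upwards [h1, h2] with p hp1 hp2
      have := hmax (hmemD τ hτ p hp1.le hp2.le)
      simp only [hw, mem_ofPred_eq] at this
      linarith
    have hd := ((((hfd τ hτ') π).hasFDerivAt).mul
      ((((hmd τ hτ') π).hasFDerivAt).sub_const M)).mul
      ((((hnd τ hτ') π).hasFDerivAt).const_sub N)
    have h0 := congrArg (fun L => L (V τ π)) (hloc.hasFDerivAt_eq_zero hd)
    simp [hmV τ hτ' π, hnV τ hτ' π] at h0
    rcases h0 with h0 | h0 | h0
    · linarith
    · linarith
    · exact h0
  have hdt : HasDerivAt (fun s => w (s, π))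
      (((-fderiv ℝ (f τ) π (V τ π)) * (m τ π - M) + f τ π * m' τ π) * (N - n τ π) +
        f τ π * (m τ π - M) * (-n' τ π) - e * 1) τ :=
    ((((hft τ hτ' π).mul ((hmt τ hτ' π).sub_const M)).mul ((hnt τ hτ' π).const_sub N))).sub
      (((hasDerivAt_id τ).sub_const t₀).const_mul e)
  -- The maximum may lie at the final time T, so only earlier times are compared.
  have h3 := nonneg_of_hasDerivAt_of_le_left hdt (by
    have h1 : ∀ᶠ s in 𝓝[<] τ, M < m s π :=
      ((hmt τ hτ' π).continuousAt.eventually_const_lt hm0).filter_mono nhdsWithin_le_nhds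
    have h2 : ∀ᶠ s in 𝓝[<] τ, n s π < N :=
      ((hnt τ hτ' π).continuousAt.eventually_lt_const hn0).filter_mono nhdsWithin_le_nhds
    have h4 : ∀ᶠ s in 𝓝[<] τ, t₀ < s :=
      (eventually_gt_nhds hτ'.1).filter_mono nhdsWithin_le_nhds
    filter_upwards [h1, h2, h4, self_mem_nhdsWithin] with s hs1 hs2 hs4 hs5
    exact hmax (hmemD s ⟨hs4.le, (le_of_lt hs5).trans hτ'.2⟩ π hs1.le hs2.le))
  rw [hfV] at h3
  have h4 : f τ π * m' τ π * (N - n τ π) ≤ 0 := mul_nonpos_of_nonpos_of_nonneg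
    (mul_nonpos_of_nonneg_of_nonpos (hf τ hτ π) (hm' τ hτ' π)) (sub_nonneg.2 hn0.le)
  have h5 : 0 ≤ f τ π * (m τ π - M) * n' τ π :=
    mul_nonneg (mul_nonneg (hf τ hτ π) (sub_nonneg.2 hm0.le)) (hn' τ hτ' π)
  linarith

lemma mulVec_single_dotProduct_inv {g : Mat3} (hg : g.PosDef) (a : Fin 3) (r : Mom) :
    (g *ᵥ Pi.single a 1) ⬝ᵥ g⁻¹ *ᵥ r = r a := by
  rw [dotProduct_mulVec, ← mulVec_transpose, mulVec_mulVec, transpose_eq_of_posDef hg.inv,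
    inv_mul_of_posDef hg, one_mulVec, single_one_dotProduct]

/-- Pairing p with the covector g e_a, Cauchy-Schwarz gives p_a² ≤ g_aa |p|². -/
lemma isCompact_momSq_le {g : Mat3} (hg : g.PosDef) (N : ℝ) :
    IsCompact {p : Mom | momSq g p ≤ N} := by
  have hb : ∀ p : Mom, ∀ a, p a ^ 2 ≤ g a a * momSq g p := by
    intro p a
    have h := sq_dotProduct_mulVec_le hg.inv.posSemidef (g *ᵥ Pi.single a 1) p
    rw [mulVec_single_dotProduct_inv hg, mulVec_single_dotProduct_inv hg, ← momSq_eq] at h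
    simpa using h
  refine Metric.isCompact_of_isClosed_isBounded
    (isClosed_le (continuous_momSq g) continuous_const) ?_
  refine (isCompact_univ_pi (fun a => isCompact_Icc (a := -Real.sqrt (g a a * N))
    (b := Real.sqrt (g a a * N)))).isBounded.subset fun p hp a _ => ?_
  exact abs_le.1 (Real.abs_le_sqrt ((hb p a).trans
    (mul_le_mul_of_nonneg_left hp hg.posSemidef.diag_nonneg)))

lemma differentiableAt_momSq (g : Mat3) (p : Mom) : DifferentiableAt ℝ (momSq g) p := by
  unfold momSq
  fun_prop

lemma fderiv_momSq {g : Mat3} (hg : g.PosDef) (p v : Mom) :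
    fderiv ℝ (momSq g) p v = 2 * ∑ a, momUp g p a * v a := by
  have hd := (differentiableAt_momSq g p).hasFDerivAt
  have h1 : HasDerivAt (fun s : ℝ => momSq g (p + s • v)) (fderiv ℝ (momSq g) p v) 0 := by
    have h2 : HasDerivAt (fun s : ℝ => p + s • v) v 0 := by
      simpa using ((hasDerivAt_id (0 : ℝ)).smul_const v).const_add p
    refine HasFDerivAt.comp_hasDerivAt (0 : ℝ) (l := momSq g) ?_ h2
    simpa using hd
  have h3 : HasDerivAt (fun s : ℝ => momSq g p + s * (2 * ∑ a, momUp g p a * v a) +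
      s ^ 2 * momSq g v) (2 * ∑ a, momUp g p a * v a) 0 := by
    have := (((hasDerivAt_id (0 : ℝ)).mul_const (2 * ∑ a, momUp g p a * v a)).const_add
      (momSq g p)).fun_add (((hasDerivAt_id (0 : ℝ)).fun_pow 2).mul_const (momSq g v))
    simpa using this
  refine h1.unique (h3.congr_of_eventuallyEq (Eventually.of_forall fun s => ?_))
  have t01 := inv_symm hg 0 1
  have t02 := inv_symm hg 0 2
  have t12 := inv_symm hg 1 2
  simp only [momSq, momUp, Fin.sum_univ_three, Pi.add_apply, Pi.smul_apply, smul_eq_mul, t01, t02,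
    t12]
  ring

/-- The momentum component of the characteristic vector field of the Vlasov equation. -/
noncomputable def vlasovField (g : Mat3) (p : Mom) : Mom := fun a =>
  (pZero g p)⁻¹ * ∑ b, ∑ d, strC d b a * momUp g p b * p d

/-- C^d_{ba} is antisymmetric in a, b while p^a p^b is symmetric. Along characteristics |p|²
therefore changes only through the metric. -/
lemma fderiv_momSq_vlasovField {g : Mat3} (hg : g.PosDef) (p : Mom) :
    fderiv ℝ (momSq g) p (vlasovField g p) = 0 := by
  rw [fderiv_momSq hg]
  simp only [vlasovField, strC, Fin.sum_univ_three]
  ring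

lemma fderiv_vlasovField (f : Mom → ℝ) (g : Mat3) (p : Mom) :
    fderiv ℝ f p (vlasovField g p) = ∑ a, (pZero g p)⁻¹ *
      (∑ b, ∑ d, strC d b a * momUp g p b * p d) * fderiv ℝ f p (Pi.single a 1) := by
  conv_lhs => rw [pi_eq_sum_univ' (vlasovField g p)]
  simp only [map_sum, map_smul, smul_eq_mul]
  rfl

namespace IsSolution

variable {t₀ t T : ℝ} {g k : ℝ → Mat3} {f : ℝ → Mom → ℝ}

lemma abs_contract_shear_le (sol : IsSolution t₀ g k f) (ht : t₀ ≤ t) (p : Mom) :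
    |p ⬝ᵥ ((g t)⁻¹ * shear (g t) (k t) * (g t)⁻¹) *ᵥ p| ≤
      Real.sqrt (shearSq (g t) (k t)) * momSq (g t) p := by
  have hg := sol.metric_posDef t ht
  have hk := sol.second_transpose ht
  have h2 := contract_sq_le hg.inv.posSemidef (shear_transpose hg hk) p p
  rw [← momSq_eq, ← shearSq, mul_assoc (shearSq _ _), ← sq] at h2
  have h3 := Real.abs_le_sqrt h2
  rwa [Real.sqrt_mul (shearSq_nonneg hg hk), Real.sqrt_sq (momSq_nonneg hg p)] at h3

lemma continuousOn_momSq (sol : IsSolution t₀ g k f) :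
    ContinuousOn (fun q : ℝ × Mom => momSq (g q.1) q.2) (Icc t₀ T ×ˢ univ) := by
  have h : ∀ a b, ContinuousOn (fun q : ℝ × Mom => (g q.1)⁻¹ a b) (Icc t₀ T ×ˢ univ) := by
    intro a b
    have h1 : ContinuousOn (fun s => (g s)⁻¹ a b) (Ici t₀) := fun s hs =>
      (sol.hasDeriv_inv hs a b).continuousWithinAt
    exact h1.comp continuousOn_fst fun q hq => hq.1.1
  have hp : ∀ a, ContinuousOn (fun q : ℝ × Mom => q.2 a) (Icc t₀ T ×ˢ univ) := fun a =>
    ((continuous_apply a).comp continuous_snd).continuousOn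
  exact continuousOn_finsetSum _ fun a _ => continuousOn_finsetSum _ fun b _ =>
    ((h a b).mul (hp a)).mul (hp b)

lemma differentiable_density (sol : IsSolution t₀ g k f) (ht : t₀ ≤ t) :
    Differentiable ℝ (f t) := by
  have h1 : ContDiffOn ℝ ∞ (fun p : Mom => f t p) univ :=
    sol.density_smooth.comp (f := fun p : Mom => (t, p)) (contDiff_prodMk_right t).contDiffOn
      fun p _ => ⟨ht, mem_univ p⟩
  exact (contDiffOn_univ.1 h1).differentiable (by simp)

/-- The momentum support stays in the sublevel sets of `θ |p|²` if `θ` decreases fast enough. -/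
lemma density_support (sol : IsSolution t₀ g k f) {θ θ' : ℝ → ℝ} {M : ℝ}
    (hθ : ∀ t ∈ Icc t₀ T, HasDerivWithinAt θ (θ' t) (Ici t₀) t)
    (hpos : ∀ t ∈ Icc t₀ T, 0 ≤ θ t)
    (hdec : ∀ t ∈ Icc t₀ T, θ' t +
      θ t * (2 * Real.sqrt (shearSq (g t) (k t)) - 2 * hubble (g t) (k t)) ≤ 0)
    (hinit : ∀ p, f t₀ p ≠ 0 → θ t₀ * momSq (g t₀) p ≤ M) :
    ∀ t ∈ Icc t₀ T, ∀ p, f t p ≠ 0 → θ t * momSq (g t) p ≤ M := by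
  intro t₁ ht₁ p₁ hf₁
  have hcH : ContinuousOn (fun t => 2 * Real.sqrt (shearSq (g t) (k t)) +
      2 * hubble (g t) (k t)) (Icc t₀ T) := by
    have h1 : ContinuousOn (fun t => shearSq (g t) (k t)) (Icc t₀ T) := fun s hs =>
      ((sol.hasDeriv_shearSq hs.1).continuousWithinAt).mono Icc_subset_Ici_self
    have h2 : ContinuousOn (fun t => hubble (g t) (k t)) (Icc t₀ T) := fun s hs =>
      ((sol.hasDeriv_hubble hs.1).continuousWithinAt).mono Icc_subset_Ici_self
    fun_prop
  obtain ⟨B, hB⟩ := isCompact_Icc.bddAbove_image hcH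
  have hB' : ∀ t ∈ Icc t₀ T, 2 * Real.sqrt (shearSq (g t) (k t)) + 2 * hubble (g t) (k t) ≤ B :=
    fun t ht => hB (mem_image_of_mem _ ht)
  set D : ℝ → Mom → ℝ := fun t p =>
    2 * (p ⬝ᵥ ((g t)⁻¹ * shear (g t) (k t) * (g t)⁻¹) *ᵥ p)
      - 2 * hubble (g t) (k t) * momSq (g t) p with hD
  have hDup : ∀ t ∈ Icc t₀ T, ∀ p, D t p ≤
      (2 * Real.sqrt (shearSq (g t) (k t)) - 2 * hubble (g t) (k t)) * momSq (g t) p := by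
    intro t ht p
    have := (abs_le.1 (sol.abs_contract_shear_le ht.1 p)).2
    simp only [hD]
    linarith
  have hDlow : ∀ t ∈ Icc t₀ T, ∀ p, -(B * momSq (g t) p) ≤ D t p := by
    intro t ht p
    have h1 := (abs_le.1 (sol.abs_contract_shear_le ht.1 p)).1
    have h2 := mul_le_mul_of_nonneg_right (hB' t ht) (momSq_nonneg (sol.metric_posDef t ht.1) p)
    simp only [hD]
    linarith
  -- The exponential outweighs the fastest possible decay of |p|², so n increases in time. Hence n ≤
  -- N at any time bounds |p|² by N in the initial metric, which is the compact set required by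
  -- `transport_support`.
  set n : ℝ → Mom → ℝ := fun t p => Real.exp (B * (t - t₀)) * momSq (g t) p with hn
  set n' : ℝ → Mom → ℝ := fun t p => Real.exp (B * (t - t₀)) * B * momSq (g t) p +
    Real.exp (B * (t - t₀)) * D t p with hn'
  have hnt : ∀ t, t₀ ≤ t → ∀ p, HasDerivWithinAt (fun s => n s p) (n' t p) (Ici t₀) t := by
    intro t ht p
    have h1 : HasDerivAt (fun s => Real.exp (B * (s - t₀))) (Real.exp (B * (t - t₀)) * B) t := by
      have := (((hasDerivAt_id t).sub_const t₀).const_mul B).exp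
      simpa using this
    exact h1.hasDerivWithinAt.fun_mul (sol.hasDeriv_momSq ht p)
  have hn'0 : ∀ t ∈ Icc t₀ T, ∀ p, 0 ≤ n' t p := by
    intro t ht p
    have := mul_le_mul_of_nonneg_left (hDlow t ht p) (Real.exp_pos (B * (t - t₀))).le
    simp only [hn']
    linarith
  have hmono : ∀ p, MonotoneOn (fun s => n s p) (Icc t₀ T) := by
    intro p
    refine monotoneOn_of_deriv_nonneg (convex_Icc _ _)
      (fun s hs => ((hnt s hs.1 p).continuousWithinAt).mono Icc_subset_Ici_self) ?_ ?_
    · rw [interior_Icc]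
      exact fun s hs => ((hnt s hs.1.le p).hasDerivAt (Ici_mem_nhds hs.1)).differentiableAt.differentiableWithinAt
    · rw [interior_Icc]
      intro s hs
      rw [((hnt s hs.1.le p).hasDerivAt (Ici_mem_nhds hs.1)).deriv]
      exact hn'0 s ⟨hs.1.le, hs.2.le⟩ p
  have hcm := sol.continuousOn_momSq (T := T)
  have hθc : ContinuousOn (fun q : ℝ × Mom => θ q.1) (Icc t₀ T ×ˢ univ) := by
    have h1 : ContinuousOn θ (Icc t₀ T) := fun s hs =>
      ((hθ s hs).continuousWithinAt).mono Icc_subset_Ici_self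
    exact h1.comp continuousOn_fst fun q hq => hq.1
  -- The `+ 1` in N puts the point (t₁, p₁) strictly inside the cutoff.
  refine transport_support (t₀ := t₀) (T := T) (N := n t₁ p₁ + 1) (f := f)
    (m := fun t p => θ t * momSq (g t) p) (n := n)
    (m' := fun t p => θ' t * momSq (g t) p + θ t * D t p) (n' := n')
    (V := fun t p => vlasovField (g t) p)
    (isCompact_momSq_le (sol.metric_posDef t₀ le_rfl) (n t₁ p₁ + 1))
    ((sol.density_smooth.continuousOn).mono (prod_mono_left Icc_subset_Ici_self))
    (hθc.mul hcm) ?_ ?_ (fun t ht p => sol.density_nonneg t ht.1 p)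
    (fun t ht => sol.differentiable_density ht.1.le)
    (fun t ht p => (differentiableAt_momSq (g t) p).const_mul _)
    (fun t ht p => (differentiableAt_momSq (g t) p).const_mul _) ?_ ?_ ?_ ?_
    (fun t ht p => (hnt t ht.1.le p).hasDerivAt (Ici_mem_nhds ht.1)) ?_
    (fun t ht p => hn'0 t ⟨ht.1.le, ht.2⟩ p) hinit t₁ ht₁ p₁ (lt_add_one _) hf₁
  · exact (Continuous.continuousOn (by fun_prop)).mul hcm
  · intro t ht p hp
    have h1 := hmono p (left_mem_Icc.2 (ht.1.trans ht.2)) ht ht.1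
    simp only [hn, sub_self, mul_zero, Real.exp_zero, one_mul] at h1 hp
    exact h1.trans hp
  · intro t ht p
    rw [fderiv_const_mul (differentiableAt_momSq (g t) p), _root_.smul_apply,
      fderiv_momSq_vlasovField (sol.metric_posDef t ht.1.le), smul_zero]
  · intro t ht p
    simp only [hn]
    rw [fderiv_const_mul (differentiableAt_momSq (g t) p), _root_.smul_apply,
      fderiv_momSq_vlasovField (sol.metric_posDef t ht.1.le), smul_zero]
  · intro t ht p
    rw [fderiv_vlasovField, ← Finset.sum_neg_distrib]
    have := (sol.vlasov t ht.1.le p).hasDerivAt (Ici_mem_nhds ht.1)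
    rwa [← Finset.sum_neg_distrib] at this
  · intro t ht p
    exact ((hθ t ⟨ht.1.le, ht.2⟩).hasDerivAt (Ici_mem_nhds ht.1)).fun_mul
      ((sol.hasDeriv_momSq ht.1.le p).hasDerivAt (Ici_mem_nhds ht.1))
  · intro t ht p
    have ht' : t ∈ Icc t₀ T := ⟨ht.1.le, ht.2⟩
    have h1 := mul_le_mul_of_nonneg_left (hDup t ht' p) (hpos t ht')
    have h2 := mul_nonpos_of_nonpos_of_nonneg (hdec t ht')
      (momSq_nonneg (sol.metric_posDef t ht'.1) p)
    linarith

end IsSolution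

/-! ### Differential inequalities -/

lemma le_of_hasDerivWithinAt_nonpos {y y' : ℝ → ℝ} {a b : ℝ} (hab : a ≤ b)
    (hy : ∀ t ∈ Icc a b, HasDerivWithinAt y (y' t) (Ici a) t) (hy' : ∀ t ∈ Icc a b, y' t ≤ 0) :
    y b ≤ y a := by
  refine antitoneOn_of_deriv_nonpos (convex_Icc a b)
    (fun s hs => ((hy s hs).continuousWithinAt).mono Icc_subset_Ici_self) ?_ ?_
    (left_mem_Icc.2 hab) (right_mem_Icc.2 hab) hab
  · rw [interior_Icc]
    exact fun s hs => ((hy s ⟨hs.1.le, hs.2.le⟩).hasDerivAt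
      (Ici_mem_nhds hs.1)).differentiableAt.differentiableWithinAt
  · rw [interior_Icc]
    intro s hs
    rw [((hy s ⟨hs.1.le, hs.2.le⟩).hasDerivAt (Ici_mem_nhds hs.1)).deriv]
    exact hy' s ⟨hs.1.le, hs.2.le⟩

/-- Integrating factor: t^a y + (C/b) t^{-b} does not increase, its second term absorbing the
forcing. The exponent `a` may be negative, and C = 0 with a dummy b covers the homogeneous
inequality. -/
lemma exists_le_rpow_of_hasDerivWithinAt {y y' : ℝ → ℝ} {T a b C : ℝ} (hT : 0 < T) (hb : 0 < b)
    (hC : 0 ≤ C) (hy : ∀ t, T ≤ t → HasDerivWithinAt y (y' t) (Ici T) t)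
    (hy' : ∀ t, T ≤ t → y' t ≤ -(a / t) * y t + C * t ^ (-a - 1 - b)) :
    ∃ C', 0 ≤ C' ∧ ∀ t, T ≤ t → y t ≤ C' * t ^ (-a) := by
  set Y : ℝ → ℝ := fun t => t ^ a * y t + C / b * t ^ (-b) with hY
  refine ⟨max (Y T) 0, le_max_right _ _, fun t ht => ?_⟩
  have ht0 : 0 < t := hT.trans_le ht
  have h1 : Y t ≤ Y T := by
    refine le_of_hasDerivWithinAt_nonpos (y := Y)
      (y' := fun s => a * s ^ (a - 1) * y s + s ^ a * y' s + C / b * (-b * s ^ (-b - 1))) ht ?_ ?_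
    · intro s hs
      have hs0 : s ≠ 0 := (hT.trans_le hs.1).ne'
      exact (((Real.hasDerivAt_rpow_const (Or.inl hs0)).hasDerivWithinAt).fun_mul
        (hy s hs.1)).fun_add
        (((Real.hasDerivAt_rpow_const (Or.inl hs0)).hasDerivWithinAt).const_mul _)
    · intro s hs
      have hs0 : 0 < s := hT.trans_le hs.1
      have h2 := mul_le_mul_of_nonneg_left (hy' s hs.1) (Real.rpow_nonneg hs0.le a)
      have h3 : s ^ a * (C * s ^ (-a - 1 - b)) = C * s ^ (-b - 1) := by
        rw [mul_left_comm, ← Real.rpow_add hs0]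
        ring_nf
      have h4 : s ^ a * (-(a / s) * y s) = -(a * s ^ (a - 1) * y s) := by
        rw [Real.rpow_sub_one hs0.ne']
        ring
      have h5 : C / b * (-b * s ^ (-b - 1)) = -(C * s ^ (-b - 1)) := by
        field_simp
      rw [mul_add, h3, h4] at h2
      rw [h5]
      linarith
  have h2 : 0 ≤ C / b * t ^ (-b) := mul_nonneg (div_nonneg hC hb.le) (Real.rpow_nonneg ht0.le _)
  have h3 : t ^ a * y t ≤ max (Y T) 0 := by
    have : Y t = t ^ a * y t + C / b * t ^ (-b) := rfl
    exact le_trans (by linarith) (le_max_left _ _)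
  have h4 : y t = t ^ a * y t * t ^ (-a) := by
    rw [mul_right_comm, ← Real.rpow_add ht0, add_neg_cancel, Real.rpow_zero, one_mul]
  rw [h4]
  exact mul_le_mul_of_nonneg_right h3 (Real.rpow_nonneg ht0.le _)

/-- Continuous induction for an open bound. -/
lemma lt_of_bootstrap {φ : ℝ → ℝ} {t₀ η : ℝ} (hc : ContinuousOn φ (Ici t₀)) (h0 : φ t₀ < η)
    (h : ∀ T, t₀ ≤ T → (∀ t ∈ Icc t₀ T, φ t ≤ η) → φ T < η) : ∀ t, t₀ ≤ t → φ t < η := by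
  intro t₁ ht₁
  by_contra! hbad
  -- The infimum of S is the first time at which η is attained. Up to then φ ≤ η, so the hypothesis
  -- contradicts equality at that time.
  set S : Set ℝ := Icc t₀ t₁ ∩ φ ⁻¹' {η} with hS
  have hivt : ∀ t ∈ Icc t₀ t₁, η ≤ φ t → ∃ s ∈ S, s ≤ t := by
    intro t ht hηt
    obtain ⟨s, hs, hsη⟩ := intermediate_value_Icc ht.1 (hc.mono Icc_subset_Ici_self) ⟨h0.le, hηt⟩
    exact ⟨s, ⟨⟨hs.1, hs.2.trans ht.2⟩, hsη⟩, hs.2⟩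
  have hSc : IsClosed S :=
    (hc.mono Icc_subset_Ici_self).preimage_isClosed_of_isClosed isClosed_Icc isClosed_singleton
  have hne : S.Nonempty := by
    obtain ⟨s, hs, -⟩ := hivt t₁ ⟨ht₁, le_rfl⟩ hbad
    exact ⟨s, hs⟩
  have hbd : BddBelow S := ⟨t₀, fun t ht => ht.1.1⟩
  have hmem : sInf S ∈ S := hSc.csInf_mem hne hbd
  have hη : φ (sInf S) = η := hmem.2
  refine absurd (h (sInf S) hmem.1.1 fun t ht => ?_) (not_lt.2 hη.ge)
  by_contra! hgt
  obtain ⟨s, hs, hst⟩ := hivt t ⟨ht.1, ht.2.trans hmem.1.2⟩ hgt.le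
  have h1 : t = sInf S := le_antisymm ht.2 ((csInf_le hbd hs).trans hst)
  rw [h1, hη] at hgt
  exact lt_irrefl _ hgt

/-! ### The normalized curvature variable -/

namespace IsSolution

variable {t₀ t T : ℝ} {g k : ℝ → Mat3} {f : ℝ → Mom → ℝ}

lemma inv_diag_pos (sol : IsSolution t₀ g k f) (ht : t₀ ≤ t) (i : Fin 3) : 0 < (g t)⁻¹ i i :=
  (sol.metric_posDef t ht).inv.diag_pos

lemma rho_nonneg (sol : IsSolution t₀ g k f) (ht : t₀ ≤ t) : 0 ≤ rho (g t) (f t) :=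
  BianchiV.rho_nonneg (sol.density_nonneg t ht)

lemma shearSq_nonneg (sol : IsSolution t₀ g k f) (ht : t₀ ≤ t) : 0 ≤ shearSq (g t) (k t) :=
  BianchiV.shearSq_nonneg (sol.metric_posDef t ht) (sol.second_transpose ht)

lemma tr_stress_nonneg (sol : IsSolution t₀ g k f) (ht : t₀ ≤ t) :
    0 ≤ tr (g t) (stress (g t) (f t)) :=
  BianchiV.tr_stress_nonneg (sol.metric_posDef t ht) (sol.differentiable_density ht).continuous
    (sol.density_compact t ht) (sol.density_nonneg t ht)

lemma tr_stress_le (sol : IsSolution t₀ g k f) (ht : t₀ ≤ t) {Q : ℝ} (hQ : 0 ≤ Q)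
    (hP : ∀ p, f t p ≠ 0 → momSq (g t) p ≤ Q) :
    tr (g t) (stress (g t) (f t)) ≤ Q * rho (g t) (f t) :=
  BianchiV.tr_stress_le (sol.metric_posDef t ht) (sol.differentiable_density ht).continuous
    (sol.density_compact t ht) (sol.density_nonneg t ht) hQ hP

lemma continuousOn_hubble (sol : IsSolution t₀ g k f) :
    ContinuousOn (fun t => hubble (g t) (k t)) (Ici t₀) := fun _ ht =>
  (sol.hasDeriv_hubble ht).continuousWithinAt

/-- At a zero of H the Hamiltonian constraint would express 0 as a sum of nonnegative terms, one of
them 6 g^{00} > 0. -/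
lemma hubble_pos (sol : IsSolution t₀ g k f) (h0 : 0 < hubble (g t₀) (k t₀)) (ht : t₀ ≤ t) :
    0 < hubble (g t) (k t) := by
  by_contra! hle
  obtain ⟨s, hs, hs0⟩ := intermediate_value_Icc' ht
    (sol.continuousOn_hubble.mono Icc_subset_Ici_self) ⟨hle, h0.le⟩
  have h1 := sol.hamiltonian_eq hs.1
  have h2 := sol.inv_diag_pos hs.1 0
  have h3 := mul_nonneg Real.pi_pos.le (sol.rho_nonneg hs.1)
  have h4 := sol.shearSq_nonneg hs.1
  simp only at hs0
  rw [hs0] at h1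
  nlinarith

lemma ATilde_eq (sol : IsSolution t₀ g k f) (ht : t₀ ≤ t) :
    ATilde (g t) (k t) = 1 - (g t)⁻¹ 0 0 / hubble (g t) (k t) ^ 2 := by
  rw [ATilde, scalarCurv_eq (sol.metric_posDef t ht), neg_mul, neg_neg,
    mul_div_mul_left _ _ (by norm_num : (6 : ℝ) ≠ 0)]

lemma inv_zero_eq (sol : IsSolution t₀ g k f) (h0 : 0 < hubble (g t₀) (k t₀)) (ht : t₀ ≤ t) :
    (g t)⁻¹ 0 0 = hubble (g t) (k t) ^ 2 * (1 - ATilde (g t) (k t)) := by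
  have h := sol.hubble_pos h0 ht
  rw [sol.ATilde_eq ht]
  field_simp
  ring

lemma six_hubble_sq_mul_ATilde (sol : IsSolution t₀ g k f)
    (h0 : 0 < hubble (g t₀) (k t₀)) (ht : t₀ ≤ t) :
    6 * hubble (g t) (k t) ^ 2 * ATilde (g t) (k t) =
      shearSq (g t) (k t) + 16 * Real.pi * rho (g t) (f t) := by
  have h1 := sol.hamiltonian_eq ht
  rw [sol.inv_zero_eq h0 ht] at h1
  linarith

lemma ATilde_nonneg (sol : IsSolution t₀ g k f) (h0 : 0 < hubble (g t₀) (k t₀)) (ht : t₀ ≤ t) :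
    0 ≤ ATilde (g t) (k t) := by
  have h1 := sol.six_hubble_sq_mul_ATilde h0 ht
  have h2 := mul_nonneg Real.pi_pos.le (sol.rho_nonneg ht)
  have h3 := sol.shearSq_nonneg ht
  have h4 := pow_pos (sol.hubble_pos h0 ht) 2
  by_contra! h
  nlinarith

lemma shearSq_le (sol : IsSolution t₀ g k f) (h0 : 0 < hubble (g t₀) (k t₀)) (ht : t₀ ≤ t) :
    shearSq (g t) (k t) ≤ 6 * hubble (g t) (k t) ^ 2 * ATilde (g t) (k t) := by
  have h1 := sol.six_hubble_sq_mul_ATilde h0 ht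
  have h2 := mul_nonneg Real.pi_pos.le (sol.rho_nonneg ht)
  linarith

lemma rho_le (sol : IsSolution t₀ g k f) (h0 : 0 < hubble (g t₀) (k t₀)) (ht : t₀ ≤ t) :
    16 * Real.pi * rho (g t) (f t) ≤
    6 * hubble (g t) (k t) ^ 2 * ATilde (g t) (k t) := by
  have h1 := sol.six_hubble_sq_mul_ATilde h0 ht
  have h3 := sol.shearSq_nonneg ht
  linarith

lemma sqrt_shearSq_le (sol : IsSolution t₀ g k f) (h0 : 0 < hubble (g t₀) (k t₀)) (ht : t₀ ≤ t)
    {c : ℝ} (hc : 0 ≤ c) (hA : 6 * ATilde (g t) (k t) ≤ c ^ 2) :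
    Real.sqrt (shearSq (g t) (k t)) ≤ c * hubble (g t) (k t) := by
  refine Real.sqrt_le_iff.2 ⟨mul_nonneg hc (sol.hubble_pos h0 ht).le, ?_⟩
  have h1 := sol.shearSq_le h0 ht
  have h2 := mul_le_mul_of_nonneg_left hA (sq_nonneg (hubble (g t) (k t)))
  linarith

lemma hasDeriv_ATilde (sol : IsSolution t₀ g k f) (h0 : 0 < hubble (g t₀) (k t₀)) (ht : t₀ ≤ t)
    {Q : ℝ} (hP : ∀ p, f t p ≠ 0 → momSq (g t) p ≤ Q ^ 2) (hQ : 0 ≤ Q) :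
    ∃ A', HasDerivWithinAt (fun s => ATilde (g s) (k s)) A' (Ici t₀) t ∧
      A' ≤ -(hubble (g t) (k t) * ATilde (g t) (k t) * (1 - ATilde (g t) (k t) - 2 * Q)) := by
  have hg := sol.metric_posDef t ht
  have hH := sol.hubble_pos h0 ht
  have hd := ((sol.hasDeriv_inv ht 0 0).fun_div ((sol.hasDeriv_hubble ht).fun_pow 2)
    (pow_ne_zero 2 hH.ne')).const_sub 1
  refine ⟨_, hd.congr_of_mem (fun s hs => sol.ATilde_eq hs) ht, ?_⟩
  have hy := abs_current_upper_zero_le hg (sol.differentiable_density ht).continuous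
    (sol.density_compact t ht) (sol.density_nonneg t ht) hP
  have hA0 := sol.ATilde_nonneg h0 ht
  have hx := sol.inv_zero_eq h0 ht
  have hx0 := sol.inv_diag_pos ht 0
  have hρ := sol.rho_nonneg ht
  have hz := sol.shearSq_nonneg ht
  have hs := sol.tr_stress_nonneg ht
  have hsix := sol.six_hubble_sq_mul_ATilde h0 ht
  have hρ' := sol.rho_le h0 ht
  rw [Matrix.sub_apply, Matrix.smul_apply, Matrix.smul_apply, sol.shear_upper_zero ht]
  simp only [smul_eq_mul]
  set H := hubble (g t) (k t)
  set A := ATilde (g t) (k t)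
  set x := (g t)⁻¹ 0 0
  set z := shearSq (g t) (k t)
  set ρ := rho (g t) (f t)
  set s := tr (g t) (stress (g t) (f t))
  set j := ∑ b, (g t)⁻¹ 0 b * current (g t) (f t) b
  have hsq : Real.sqrt (x * Q ^ 2) ≤ H * Q := by
    refine Real.sqrt_le_iff.2 ⟨mul_nonneg hH.le hQ, ?_⟩
    rw [hx]
    nlinarith [mul_nonneg (mul_nonneg (sq_nonneg H) hA0) (sq_nonneg Q)]
  have hj : Real.pi * |j| ≤ H * Q * (Real.pi * ρ) := by
    have := mul_le_mul_of_nonneg_left (hy.trans (mul_le_mul_of_nonneg_right hsq hρ)) Real.pi_pos.le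
    linarith
  -- The constraint gives 16πρ ≤ 6H²Ã, so the current is itself proportional to Ã; this is the
  -- origin of the loss 2Q in the damping rate.
  have hj' : Real.pi * j ≤ H * Q * (3 / 8 * H ^ 2 * A) := by
    have h1 := mul_le_mul_of_nonneg_left (le_abs_self j) Real.pi_pos.le
    have h2 : Real.pi * ρ ≤ 3 / 8 * H ^ 2 * A := by linarith
    exact h1.trans (hj.trans (mul_le_mul_of_nonneg_left h2 (mul_nonneg hH.le hQ)))
  have hπs : 0 ≤ x * (Real.pi * s) := mul_nonneg hx0.le (mul_nonneg Real.pi_pos.le hs)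
  have hxz : 0 ≤ x * z := mul_nonneg hx0.le hz
  have hxρ : x * (16 * Real.pi * ρ) = x * (6 * H ^ 2 * A - z) := by rw [hsix]; ring
  rw [neg_le_neg_iff, le_div_iff₀ (pow_pos (pow_pos hH 2) 2)]
  -- The damping comes from ρ = (6H²Ã - |σ|²)/(16π) in the Raychaudhuri equation. The resulting -x
  -- z/6 is outweighed by 2 x z/3, and the stress term has the good sign.
  have hmain : H * A * (1 - A - 2 * Q) * H ^ 3 ≤
      2 * (-(8 * Real.pi / 3) * j) * H + 2 / 3 * (x * z) + 8 / 3 * (x * (Real.pi * s)) +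
        1 / 6 * (x * (16 * Real.pi * ρ)) := by
    rw [hxρ]
    have h1 := mul_le_mul_of_nonneg_right hj' hH.le
    have h2 : x * (6 * H ^ 2 * A - z) = 6 * H ^ 4 * A * (1 - A) - x * z := by rw [hx]; ring
    rw [h2]
    linarith
  have := mul_le_mul_of_nonneg_right hmain hH.le
  push_cast
  linarith

end IsSolution

/-! ### Late-time estimates -/

namespace IsSolution

variable {t₀ t T : ℝ} {g k : ℝ → Mat3} {f : ℝ → Mom → ℝ}

/-- Small data stay small: `Ã` does not grow and the momentum support shrinks. -/
lemma small_data (sol : IsSolution t₀ g k f) (h0 : 0 < hubble (g t₀) (k t₀))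
    (hA : ATilde (g t₀) (k t₀) < 1 / 600)
    (hP : ∀ p, f t₀ p ≠ 0 → momSq (g t₀) p ≤ (1 / 600) ^ 2) (ht : t₀ ≤ t) :
    ATilde (g t) (k t) < 1 / 600 ∧ ∀ p, f t p ≠ 0 → momSq (g t) p ≤ (1 / 600) ^ 2 := by
  have hsupp : ∀ T, (∀ t ∈ Icc t₀ T, ATilde (g t) (k t) ≤ 1 / 600) →
      ∀ t ∈ Icc t₀ T, ∀ p, f t p ≠ 0 → momSq (g t) p ≤ (1 / 600) ^ 2 := by
    intro T hT
    -- With weight 1 it suffices that |σ| ≤ H. The bound 1/600 gives |σ| ≤ H/10, since 6/600 =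
    -- (1/10)².
    have := sol.density_support (T := T) (θ := fun _ => 1) (θ' := fun _ => 0) (M := (1 / 600) ^ 2)
      (fun t _ => hasDerivWithinAt_const _ _ _) (fun t _ => zero_le_one) (fun t ht => by
        have h1 := sol.sqrt_shearSq_le h0 ht.1 (c := 1 / 10) (by norm_num) (by
          have := hT t ht
          norm_num at this ⊢
          linarith)
        have h2 := sol.hubble_pos h0 ht.1
        linarith) (by simpa using hP)
    simpa using this
  have key : ∀ t, t₀ ≤ t → ATilde (g t) (k t) < 1 / 600 := by
    refine lt_of_bootstrap (fun t ht => ?_) hA fun T hT hle => ?_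
    · have h2 := (sol.hasDeriv_inv ht 0 0).continuousWithinAt
      have h3 : ContinuousWithinAt (fun t => 1 - (g t)⁻¹ 0 0 / hubble (g t) (k t) ^ 2) (Ici t₀) t :=
        continuousWithinAt_const.sub (h2.div ((sol.continuousOn_hubble t ht).pow 2)
          (pow_ne_zero 2 (sol.hubble_pos h0 ht).ne'))
      exact h3.congr_of_mem (fun s hs => sol.ATilde_eq hs) ht
    · have hs := hsupp T hle
      have hex : ∀ t, t ∈ Icc t₀ T → ∃ A', HasDerivWithinAt (fun s => ATilde (g s) (k s)) A'
          (Ici t₀) t ∧ A' ≤ 0 := by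
        intro t ht
        obtain ⟨A', h1, h2⟩ := sol.hasDeriv_ATilde h0 ht.1 (hs t ht) (by norm_num)
        refine ⟨A', h1, h2.trans (neg_nonpos.2 (mul_nonneg (mul_nonneg
          (sol.hubble_pos h0 ht.1).le (sol.ATilde_nonneg h0 ht.1)) ?_))⟩
        have := hle t ht
        linarith
      choose! A' hA' using hex
      exact (le_of_hasDerivWithinAt_nonpos hT (fun t ht => (hA' t ht).1)
        fun t ht => (hA' t ht).2).trans_lt hA
  exact ⟨key t ht, hsupp t (fun s hs => (key s hs.1).le) t ⟨ht, le_rfl⟩⟩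

/-- First decay rates for small data. -/
lemma first_decay (sol : IsSolution t₀ g k f) (ht₀ : 0 < t₀) (h0 : hubble (g t₀) (k t₀) = t₀⁻¹)
    (hA : ATilde (g t₀) (k t₀) < 1 / 600)
    (hP : ∀ p, f t₀ p ≠ 0 → momSq (g t₀) p ≤ (1 / 600) ^ 2) :
    ∃ C, 0 ≤ C ∧ ∀ t, t₀ ≤ t →
      t ≤ (hubble (g t) (k t))⁻¹ ∧
      (hubble (g t) (k t))⁻¹ ≤ 301 / 300 * t ∧
      (hubble (g t) (k t))⁻¹ ≤ t + C * t ^ (1 / 2 : ℝ) ∧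
      ATilde (g t) (k t) ≤ C * t ^ (-(1 / 2) : ℝ) ∧
      (∀ p, f t p ≠ 0 → momSq (g t) p ≤ C * t ^ (-(3 / 2) : ℝ)) ∧
      16 * Real.pi * tr (g t) (stress (g t) (f t)) ≤ C * t ^ (-4 : ℝ) := by
  have h0' : 0 < hubble (g t₀) (k t₀) := h0 ▸ inv_pos.2 ht₀
  have hH : ∀ t, t₀ ≤ t → 0 < hubble (g t) (k t) := fun t ht => sol.hubble_pos h0' ht
  have hsm : ∀ t, t₀ ≤ t → ATilde (g t) (k t) < 1 / 600 ∧
      ∀ p, f t p ≠ 0 → momSq (g t) p ≤ (1 / 600) ^ 2 := fun t ht => sol.small_data h0' hA hP ht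
  have hA0 : ∀ t, t₀ ≤ t → 0 ≤ ATilde (g t) (k t) := fun t ht => sol.ATilde_nonneg h0' ht
  -- the derivative of `1 / H`
  have hex : ∀ t, t₀ ≤ t → ∃ q, HasDerivWithinAt (fun s => (hubble (g s) (k s))⁻¹) (1 + q)
      (Ici t₀) t ∧ 0 ≤ q ∧ q ≤ 2 * ATilde (g t) (k t) := by
    intro t ht
    have hd := (sol.hasDeriv_hubble ht).fun_inv (hH t ht).ne'
    refine ⟨(shearSq (g t) (k t) / 3 + 4 * Real.pi / 3 * (tr (g t) (stress (g t) (f t)) +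
      rho (g t) (f t))) / hubble (g t) (k t) ^ 2, ?_, ?_, ?_⟩
    · refine hd.congr_deriv ?_
      have := pow_ne_zero 2 (hH t ht).ne'
      rw [div_eq_iff this, add_mul, div_mul_cancel₀ _ this]
      ring
    · have h1 := sol.shearSq_nonneg ht
      have h2 := sol.tr_stress_nonneg ht
      have h3 := sol.rho_nonneg ht
      positivity
    -- Since S ≤ ρ, one has q H² ≤ (|σ|² + 16πρ)/3 = 2H²Ã.
    · rw [div_le_iff₀ (pow_pos (hH t ht) 2)]
      have h1 := sol.tr_stress_le ht (by norm_num) (hsm t ht).2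
      have h2 := sol.six_hubble_sq_mul_ATilde h0' ht
      have h3 := sol.rho_nonneg ht
      have h4 : Real.pi * tr (g t) (stress (g t) (f t)) ≤ Real.pi * rho (g t) (f t) :=
        mul_le_mul_of_nonneg_left (by nlinarith) Real.pi_pos.le
      have h5 := mul_nonneg Real.pi_pos.le h3
      linarith
  choose! q hq using hex
  have hlow : ∀ t, t₀ ≤ t → t ≤ (hubble (g t) (k t))⁻¹ := by
    intro t ht
    have := le_of_hasDerivWithinAt_nonpos (y := fun s => s - (hubble (g s) (k s))⁻¹)
      (y' := fun s => 1 - (1 + q s)) ht (fun s hs =>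
        (hasDerivWithinAt_id s _).sub (hq s hs.1).1) (fun s hs => by
        have := (hq s hs.1).2.1
        linarith)
    simp only [h0, inv_inv] at this
    linarith
  -- Here 301/300 = 1 + 2/600 bounds the derivative 1 + q.
  have hup : ∀ t, t₀ ≤ t → (hubble (g t) (k t))⁻¹ ≤ 301 / 300 * t := by
    intro t ht
    have := le_of_hasDerivWithinAt_nonpos (y := fun s => (hubble (g s) (k s))⁻¹ - 301 / 300 * s)
      (y' := fun s => (1 + q s) - 301 / 300 * 1) ht (fun s hs =>
        (hq s hs.1).1.sub ((hasDerivWithinAt_id s _).const_mul _)) (fun s hs => by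
        have h1 := (hq s hs.1).2.2
        have h2 := (hsm s hs.1).1
        linarith)
    simp only [h0, inv_inv] at this
    linarith
  have hHlow : ∀ t, t₀ ≤ t → 300 / 301 / t ≤ hubble (g t) (k t) := by
    intro t ht
    have h1 := hup t ht
    have h2 : 0 < t := ht₀.trans_le ht
    rw [inv_le_iff_one_le_mul₀ (hH t ht)] at h1
    rw [div_le_iff₀ h2]
    linarith
  have hHup : ∀ t, t₀ ≤ t → hubble (g t) (k t) ≤ t⁻¹ := fun t ht =>
    (le_inv_comm₀ (ht₀.trans_le ht) (hH t ht)).1 (hlow t ht)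
  -- decay of `Ã`
  obtain ⟨C₁, hC₁, hAdec⟩ : ∃ C, 0 ≤ C ∧ ∀ t, t₀ ≤ t → ATilde (g t) (k t) ≤
      C * t ^ (-(1 / 2) : ℝ) := by
    have hexA : ∀ t, t₀ ≤ t → ∃ A', HasDerivWithinAt (fun s => ATilde (g s) (k s)) A'
        (Ici t₀) t ∧ A' ≤ -(1 / 2 / t) * ATilde (g t) (k t) + 0 * t ^ (-(1 / 2) - 1 - 1 : ℝ) := by
      intro t ht
      obtain ⟨A', h1, h2⟩ := sol.hasDeriv_ATilde h0' ht (hsm t ht).2 (by norm_num)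
      refine ⟨A', h1, h2.trans ?_⟩
      have h3 := (hsm t ht).1
      have h4 : 1 / 2 / t ≤ hubble (g t) (k t) * (1 - ATilde (g t) (k t) - 2 * (1 / 600)) := by
        have h5 : 0 < t⁻¹ := inv_pos.2 (ht₀.trans_le ht)
        have h6 := hHlow t ht
        rw [div_eq_mul_inv] at h6 ⊢
        nlinarith [hH t ht]
      have := mul_le_mul_of_nonneg_right h4 (hA0 t ht)
      linarith
    choose! A' hA' using hexA
    exact exists_le_rpow_of_hasDerivWithinAt ht₀ one_pos le_rfl (fun t ht => (hA' t ht).1)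
      fun t ht => (hA' t ht).2
  -- the improved estimate of `1 / H`
  obtain ⟨C₂, hC₂, hHdec⟩ : ∃ C, 0 ≤ C ∧ ∀ t, t₀ ≤ t →
      (hubble (g t) (k t))⁻¹ ≤ t + C * t ^ (1 / 2 : ℝ) := by
    -- Integrating q ≤ 2C₁ s^{-1/2} gives 4C₁ t^{1/2}.
    refine ⟨4 * C₁, by linarith, fun t ht => ?_⟩
    have := le_of_hasDerivWithinAt_nonpos
      (y := fun s => (hubble (g s) (k s))⁻¹ - s - 4 * C₁ * s ^ (1 / 2 : ℝ))
      (y' := fun s => (1 + q s) - 1 - 4 * C₁ * (1 / 2 * s ^ (1 / 2 - 1 : ℝ))) ht (fun s hs =>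
        ((hq s hs.1).1.sub (hasDerivWithinAt_id s _)).sub
          ((Real.hasDerivAt_rpow_const (Or.inl (ht₀.trans_le hs.1).ne')).hasDerivWithinAt.const_mul
            _)) (fun s hs => by
        have h1 := (hq s hs.1).2.2
        have h2 := hAdec s hs.1
        rw [show (-(1 / 2) : ℝ) = 1 / 2 - 1 by norm_num] at h2
        linarith)
    simp only [h0, inv_inv] at this
    have h3 : 0 ≤ 4 * C₁ * t₀ ^ (1 / 2 : ℝ) := by positivity
    linarith
  -- decay of the momenta
  obtain ⟨C₃, hC₃, hPdec⟩ : ∃ C, 0 ≤ C ∧ ∀ t, t₀ ≤ t → ∀ p, f t p ≠ 0 →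
      momSq (g t) p ≤ C * t ^ (-(3 / 2) : ℝ) := by
    refine ⟨t₀ ^ (3 / 2 : ℝ) * (1 / 600) ^ 2, by positivity, fun t ht p hp => ?_⟩
    -- The weight t^{3/2} is admissible because 3/2 < 2(1 - 1/10)(300/301).
    have h1 := sol.density_support (T := t) (θ := fun s => s ^ (3 / 2 : ℝ))
      (θ' := fun s => 3 / 2 * s ^ (3 / 2 - 1 : ℝ)) (M := t₀ ^ (3 / 2 : ℝ) * (1 / 600) ^ 2)
      (fun s hs => (Real.hasDerivAt_rpow_const
        (Or.inl (ht₀.trans_le hs.1).ne')).hasDerivWithinAt)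
      (fun s hs => Real.rpow_nonneg (ht₀.trans_le hs.1).le _) (fun s hs => by
        have hs0 : 0 < s := ht₀.trans_le hs.1
        have h2 := sol.sqrt_shearSq_le h0' hs.1 (c := 1 / 10) (by norm_num) (by
          have := (hsm s hs.1).1
          norm_num at this ⊢
          linarith)
        have h3 := hHlow s hs.1
        have h4 : 0 < s ^ (3 / 2 : ℝ) := Real.rpow_pos_of_pos hs0 _
        have h5 : 0 < s⁻¹ := inv_pos.2 hs0
        have h6 : 3 / 2 * s⁻¹ + (2 * Real.sqrt (shearSq (g s) (k s)) -
            2 * hubble (g s) (k s)) ≤ 0 := by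
          rw [div_eq_mul_inv] at h3
          linarith
        rw [Real.rpow_sub_one hs0.ne']
        have := mul_nonpos_of_nonneg_of_nonpos h4.le h6
        rw [mul_add] at this
        calc _ = _ := by ring
          _ ≤ 0 := this)
      (fun p hp => mul_le_mul_of_nonneg_left (hP p hp) (Real.rpow_nonneg ht₀.le _))
      t ⟨ht, le_rfl⟩ p hp
    have ht0 : 0 < t := ht₀.trans_le ht
    have h2 := mul_le_mul_of_nonneg_right h1 (Real.rpow_nonneg ht0.le (-(3 / 2)))
    rwa [mul_right_comm, ← Real.rpow_add ht0, add_neg_cancel, Real.rpow_zero, one_mul] at h2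
  -- decay of the stress
  have hsdec : ∀ t, t₀ ≤ t → 16 * Real.pi * tr (g t) (stress (g t) (f t)) ≤
      6 * C₁ * C₃ * t ^ (-4 : ℝ) := by
    intro t ht
    have ht0 : 0 < t := ht₀.trans_le ht
    have hQ : 0 ≤ C₃ * t ^ (-(3 / 2) : ℝ) := mul_nonneg hC₃ (Real.rpow_nonneg ht0.le _)
    have h1 := sol.tr_stress_le ht hQ (hPdec t ht)
    have h2 := sol.rho_le h0' ht
    have h3 : hubble (g t) (k t) ^ 2 ≤ (t⁻¹) ^ 2 :=
      pow_le_pow_left₀ (hH t ht).le (hHup t ht) 2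
    have h4 : 16 * Real.pi * rho (g t) (f t) ≤ 6 * ((t⁻¹) ^ 2 * (C₁ * t ^ (-(1 / 2) : ℝ))) := by
      refine h2.trans ?_
      rw [mul_assoc]
      exact mul_le_mul_of_nonneg_left (mul_le_mul h3 (hAdec t ht) (hA0 t ht) (sq_nonneg _))
        (by norm_num)
    -- The three factors are the rates of H², Ã and |p|².
    have h5 : t ^ (-4 : ℝ) = (t⁻¹) ^ 2 * t ^ (-(1 / 2) : ℝ) * t ^ (-(3 / 2) : ℝ) := by
      rw [show (t⁻¹) ^ 2 = t ^ (-2 : ℝ) by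
        rw [Real.rpow_neg ht0.le, Real.rpow_two, inv_pow], ← Real.rpow_add ht0, ← Real.rpow_add ht0]
      norm_num
    calc 16 * Real.pi * tr (g t) (stress (g t) (f t))
        ≤ 16 * Real.pi * (C₃ * t ^ (-(3 / 2) : ℝ) * rho (g t) (f t)) :=
          mul_le_mul_of_nonneg_left h1 (by positivity)
      _ = C₃ * t ^ (-(3 / 2) : ℝ) * (16 * Real.pi * rho (g t) (f t)) := by ring
      _ ≤ C₃ * t ^ (-(3 / 2) : ℝ) * (6 * ((t⁻¹) ^ 2 * (C₁ * t ^ (-(1 / 2) : ℝ)))) :=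
          mul_le_mul_of_nonneg_left h4 hQ
      _ = _ := by rw [h5]; ring
  refine ⟨C₁ + C₂ + C₃ + 6 * C₁ * C₃, by positivity, fun t ht => ?_⟩
  have ht0 : 0 < t := ht₀.trans_le ht
  have h13 : 0 ≤ C₁ * C₃ := mul_nonneg hC₁ hC₃
  refine ⟨hlow t ht, hup t ht, (hHdec t ht).trans ?_, (hAdec t ht).trans ?_,
    fun p hp => (hPdec t ht p hp).trans ?_, (hsdec t ht).trans ?_⟩
  · exact add_le_add_right (mul_le_mul_of_nonneg_right (by linarith)
      (Real.rpow_nonneg ht0.le _)) _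
  all_goals exact mul_le_mul_of_nonneg_right (by linarith) (Real.rpow_nonneg ht0.le _)

end IsSolution

lemma momSq_single (g : Mat3) (i : Fin 3) : momSq g (Pi.single i 1) = g⁻¹ i i := by
  rw [momSq_eq, single_one_dotProduct, mulVec_single_one]
  rfl

lemma momSq_mulVec_single {g : Mat3} (hg : g.PosDef) (j : Fin 3) :
    momSq g (g *ᵥ Pi.single j 1) = g j j := by
  rw [momSq_eq, mulVec_single_dotProduct_inv hg, mulVec_single_one]
  rfl

/-- The frame is not orthonormal, so |σ| alone does not bound a mixed component; g^{ii} and g_jj are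
the squared lengths of the two covectors e_i and g e_j contracted with σ. -/
lemma sq_inv_mul_shear_le {g k : Mat3} (hg : g.PosDef) (hk : kᵀ = k) (i j : Fin 3) :
    (g⁻¹ * shear g k) i j ^ 2 ≤ shearSq g k * g⁻¹ i i * g j j := by
  have h := contract_sq_le hg.inv.posSemidef (shear_transpose hg hk) (Pi.single i 1)
    (g *ᵥ Pi.single j 1)
  rw [← shearSq, ← momSq_eq, ← momSq_eq, momSq_single, momSq_mulVec_single hg, mulVec_mulVec,
    Matrix.mul_assoc, inv_mul_of_posDef hg, Matrix.mul_one, single_one_dotProduct,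
    mulVec_single_one] at h
  exact h

namespace IsSolution

variable {t₀ t T : ℝ} {g k : ℝ → Mat3} {f : ℝ → Mom → ℝ}

lemma abs_shear_diag_le (sol : IsSolution t₀ g k f) (ht : t₀ ≤ t) (j : Fin 3) :
    |shear (g t) (k t) j j| ≤ Real.sqrt (shearSq (g t) (k t)) * g t j j := by
  have hg := sol.metric_posDef t ht
  have h := sol.abs_contract_shear_le ht (g t *ᵥ Pi.single j 1)
  rw [momSq_mulVec_single hg, mulVec_mulVec, Matrix.mul_assoc, inv_mul_of_posDef hg, Matrix.mul_one,
    ← mulVec_mulVec, mulVec_single_dotProduct_inv hg, mulVec_single_one] at h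
  exact h

lemma abs_contract_shear_diag_le (sol : IsSolution t₀ g k f) (ht : t₀ ≤ t) (i : Fin 3) :
    |((g t)⁻¹ * shear (g t) (k t) * (g t)⁻¹) i i| ≤
      Real.sqrt (shearSq (g t) (k t)) * (g t)⁻¹ i i := by
  have h := sol.abs_contract_shear_le ht (Pi.single i 1)
  rw [momSq_single, single_one_dotProduct, mulVec_single_one] at h
  exact h

/-- Sharp decay of the shear. -/
lemma shear_decay (sol : IsSolution t₀ g k f) (ht₀ : 0 < t₀)
    (h0 : hubble (g t₀) (k t₀) = t₀⁻¹)
    (hA : ATilde (g t₀) (k t₀) < 1 / 600)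
    (hP : ∀ p, f t₀ p ≠ 0 → momSq (g t₀) p ≤ (1 / 600) ^ 2) {ε : ℝ} (hε : 0 < ε) (hε1 : ε ≤ 1)
    (i j : Fin 3) :
    (fun t => Sig (g t) (k t) i j) =O[atTop] (fun t : ℝ => t ^ (-2 + ε)) := by
  obtain ⟨C, hC, hall⟩ := sol.first_decay ht₀ h0 hA hP
  have h0' : 0 < hubble (g t₀) (k t₀) := h0 ▸ inv_pos.2 ht₀
  -- Beyond T both 1 - Ht and |σ|/H are at most ε/16, which costs less than the loss allowed in each
  -- exponent below.
  obtain ⟨T, hT₀, hsmall⟩ : ∃ T, t₀ ≤ T ∧ ∀ t, T ≤ t → C * t ^ (-(1 / 2) : ℝ) ≤ ε / 16 ∧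
      6 * (C * t ^ (-(1 / 2) : ℝ)) ≤ (ε / 16) ^ 2 := by
    have h1 : Tendsto (fun t : ℝ => C * t ^ (-(1 / 2) : ℝ)) atTop (nhds 0) := by
      simpa using (tendsto_rpow_neg_atTop (by norm_num : (0 : ℝ) < 1 / 2)).const_mul C
    have h2 : Tendsto (fun t : ℝ => 6 * (C * t ^ (-(1 / 2) : ℝ))) atTop (nhds 0) := by
      simpa using h1.const_mul 6
    have h3 := (h1.eventually_le_const (by positivity : (0 : ℝ) < ε / 16)).and
      (h2.eventually_le_const (by positivity : (0 : ℝ) < (ε / 16) ^ 2))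
    obtain ⟨T, hT⟩ := eventually_atTop.1 h3
    exact ⟨max T t₀, le_max_right _ _, fun t ht => hT t ((le_max_left _ _).trans ht)⟩
  have hTpos : 0 < T := ht₀.trans_le hT₀
  have hpos : ∀ t, T ≤ t → 0 < t := fun t ht => hTpos.trans_le ht
  have hH : ∀ t, T ≤ t → 0 < hubble (g t) (k t) := fun t ht => sol.hubble_pos h0' (hT₀.trans ht)
  have hHup : ∀ t, T ≤ t → hubble (g t) (k t) ≤ t⁻¹ := fun t ht =>
    (le_inv_comm₀ (hpos t ht) (hH t ht)).1 (hall t (hT₀.trans ht)).1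
  have hHlow : ∀ t, T ≤ t → (1 - ε / 16) * t⁻¹ ≤ hubble (g t) (k t) := by
    intro t ht
    have h1 := (hall t (hT₀.trans ht)).2.2.1
    have h2 := (hsmall t ht).1
    have ht0 := hpos t ht
    have h3 : t ^ (1 / 2 : ℝ) = t * t ^ (-(1 / 2) : ℝ) := by
      rw [← Real.rpow_one_add' ht0.le (by norm_num)]
      norm_num
    rw [h3, inv_le_iff_one_le_mul₀ (hH t ht)] at h1
    rw [← div_eq_mul_inv, div_le_iff₀ ht0]
    have h4 : 1 ≤ t * hubble (g t) (k t) * (1 + ε / 16) := by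
      have := mul_le_mul_of_nonneg_left h2 (mul_nonneg ht0.le (hH t ht).le)
      linarith
    nlinarith [mul_pos ht0 (hH t ht)]
  have hsq : ∀ t, T ≤ t →
      Real.sqrt (shearSq (g t) (k t)) ≤ ε / 16 * hubble (g t) (k t) := fun t ht =>
    sol.sqrt_shearSq_le h0' (hT₀.trans ht) (by positivity) (le_trans
      (mul_le_mul_of_nonneg_left (hall t (hT₀.trans ht)).2.2.2.1 (by norm_num)) (hsmall t ht).2)
  have hsub : Ici T ⊆ Ici t₀ := Ici_subset_Ici.2 hT₀
  have hpow : ∀ t : ℝ, 0 < t → ∀ a : ℝ, 0 ≤ t ^ a := fun t ht a => Real.rpow_nonneg ht.le a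
  -- Of the loss ε in the exponent 6 - ε, the bound on H uses 6ε/16 and Young's inequality ε/2.
  obtain ⟨Cz, hCz, hz⟩ := exists_le_rpow_of_hasDerivWithinAt (y := fun t => shearSq (g t) (k t))
    (a := 6 - ε) (b := ε) (C := C ^ 2 / (2 * ε)) hTpos hε (by positivity)
    (fun t ht => (sol.hasDeriv_shearSq (hT₀.trans ht)).mono hsub) (fun t ht => by
      have ht' := hT₀.trans ht
      have ht0 := hpos t ht
      have h1 := abs_trace_shear_stress_le (sol.metric_posDef t ht') (sol.second_transpose ht')
        (sol.differentiable_density ht').continuous (sol.density_compact t ht')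
        (sol.density_nonneg t ht')
      have h2 := (hall t ht').2.2.2.2.2
      have h3 := sol.tr_stress_nonneg ht'
      have h4 := sol.shearSq_nonneg ht'
      have h5 := hHlow t ht
      set z := shearSq (g t) (k t)
      set s := tr (g t) (stress (g t) (f t))
      set w := trace ((g t)⁻¹ * shear (g t) (k t) * ((g t)⁻¹ * stress (g t) (f t)))
      have h6 : -(16 * Real.pi * w) ≤ Real.sqrt z * (C * t ^ (-4 : ℝ)) := by
        have h7 : 16 * Real.pi * (-w) ≤ 16 * Real.pi * (Real.sqrt z * s) :=
          mul_le_mul_of_nonneg_left ((neg_le_abs w).trans h1) (by positivity)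
        have h8 := mul_le_mul_of_nonneg_left h2 (Real.sqrt_nonneg z)
        linarith
      -- Young's inequality, weighted so that half the allowed loss absorbs √z; the remainder is of
      -- order t · t^{-8} = t^{-7}, integrable against t^{6-ε}.
      have h9 : Real.sqrt z * (C * t ^ (-4 : ℝ)) ≤
          ε / 2 * t⁻¹ * z + t / (2 * ε) * (C * t ^ (-4 : ℝ)) ^ 2 := by
        have h10 := sq_nonneg (ε * t⁻¹ * Real.sqrt z - C * t ^ (-4 : ℝ))
        have h11 := Real.sq_sqrt h4
        have h12 : ε / 2 * t⁻¹ * z + t / (2 * ε) * (C * t ^ (-4 : ℝ)) ^ 2 -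
            Real.sqrt z * (C * t ^ (-4 : ℝ)) =
            t / (2 * ε) * (ε * t⁻¹ * Real.sqrt z - C * t ^ (-4 : ℝ)) ^ 2 := by
          field_simp
          linear_combination (-ε ^ 2) * h11
        have h13 := mul_nonneg (show 0 ≤ t / (2 * ε) by positivity) h10
        linarith
      have h14 : t * (t ^ (-4 : ℝ)) ^ 2 = t ^ (-(6 - ε) - 1 - ε) := by
        rw [← Real.rpow_natCast, ← Real.rpow_mul ht0.le, ← Real.rpow_one_add' ht0.le (by norm_num)]
        congr 1
        push_cast
        ring
      have h15 : t / (2 * ε) * (C * t ^ (-4 : ℝ)) ^ 2 =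
          C ^ 2 / (2 * ε) * t ^ (-(6 - ε) - 1 - ε) := by
        rw [← h14]
        ring
      have h16 := mul_le_mul_of_nonneg_right h5 h4
      have h17 : 0 ≤ ε * t⁻¹ * z := by positivity
      rw [h15] at h9
      rw [div_eq_mul_inv (6 - ε)]
      linarith)
  obtain ⟨Ch, hCh, hh⟩ := exists_le_rpow_of_hasDerivWithinAt (y := fun t => (g t)⁻¹ i i)
    (a := 2 - ε / 2) (b := 1) (C := 0) hTpos one_pos le_rfl
    (fun t ht => (sol.hasDeriv_inv (hT₀.trans ht) i i).mono hsub) (fun t ht => by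
      have ht' := hT₀.trans ht
      have ht0 := hpos t ht
      have h1 := (le_abs_self _).trans (sol.abs_contract_shear_diag_le ht' i)
      have h2 := sol.inv_diag_pos ht' i
      have h3 : 2 * Real.sqrt (shearSq (g t) (k t)) - 2 * hubble (g t) (k t) ≤
          -((2 - ε / 2) * t⁻¹) := by
        have h4 := hsq t ht
        have h5 := hHlow t ht
        have h6 : 0 < t⁻¹ := inv_pos.2 ht0
        have h7 := mul_le_mul_of_nonneg_left h5 (show 0 ≤ 1 - ε / 16 by linarith)
        nlinarith [mul_pos h6 hε, mul_pos (mul_pos h6 hε) hε]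
      have h8 := mul_le_mul_of_nonneg_right h3 h2.le
      rw [Matrix.sub_apply, Matrix.smul_apply, Matrix.smul_apply, smul_eq_mul, smul_eq_mul,
        div_eq_mul_inv (2 - ε / 2)]
      linarith)
  obtain ⟨Cg, hCg, hgj⟩ := exists_le_rpow_of_hasDerivWithinAt (y := fun t => g t j j)
    (a := -(2 + ε / 2)) (b := 1) (C := 0) hTpos one_pos le_rfl
    (fun t ht => (sol.hasDeriv_metric (hT₀.trans ht) j j).mono hsub) (fun t ht => by
      have ht' := hT₀.trans ht
      have ht0 := hpos t ht
      have h1 := (neg_le_abs _).trans (sol.abs_shear_diag_le ht' j)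
      have h2 : 0 < g t j j := (sol.metric_posDef t ht').diag_pos
      have h3 : 2 * Real.sqrt (shearSq (g t) (k t)) + 2 * hubble (g t) (k t) ≤
          (2 + ε / 2) * t⁻¹ := by
        have h4 := hsq t ht
        have h5 := hHup t ht
        have h6 := mul_le_mul_of_nonneg_left h5 hε.le
        have h7 : 0 < ε * t⁻¹ := mul_pos hε (inv_pos.2 ht0)
        linarith
      have h8 := mul_le_mul_of_nonneg_right h3 h2.le
      rw [neg_div, neg_neg, div_eq_mul_inv (2 + ε / 2)]
      linarith)
  refine IsBigO.of_bound (Real.sqrt (2 * (Cz * Ch * Cg))) ?_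
  filter_upwards [eventually_ge_atTop T] with t ht
  have ht' := hT₀.trans ht
  have ht0 := hpos t ht
  have hg := sol.metric_posDef t ht'
  have h1 := sq_inv_mul_shear_le hg (sol.second_transpose ht') i j
  have h2 : (hubble (g t) (k t))⁻¹ ^ 2 ≤ 2 * t ^ 2 := by
    have h3 := (hall t ht').2.1
    have h4 := pow_le_pow_left₀ (inv_pos.2 (hH t ht)).le h3 2
    nlinarith [sq_nonneg t]
  have hz0 := sol.shearSq_nonneg ht'
  have hh0 := (sol.inv_diag_pos ht' i).le
  have h5 : shearSq (g t) (k t) * (g t)⁻¹ i i * g t j j ≤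
      Cz * t ^ (-(6 - ε)) * (Ch * t ^ (-(2 - ε / 2))) * (Cg * t ^ (- -(2 + ε / 2))) :=
    mul_le_mul (mul_le_mul (hz t ht) (hh t ht) hh0 (mul_nonneg hCz (hpow t ht0 _))) (hgj t ht)
      hg.posSemidef.diag_nonneg
      (mul_nonneg (mul_nonneg hCz (hpow t ht0 _)) (mul_nonneg hCh (hpow t ht0 _)))
  -- Rates of |σ|², g^{ii}, g_jj and H^{-2}: the losses ε + ε/2 + ε/2 sum to 2ε, and the square root
  -- leaves ε.
  have h6 : t ^ (-(6 - ε)) * t ^ (-(2 - ε / 2)) * t ^ (- -(2 + ε / 2)) * t ^ 2 =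
      (t ^ (-2 + ε)) ^ 2 := by
    rw [← Real.rpow_natCast (t ^ (-2 + ε)), ← Real.rpow_mul ht0.le, ← Real.rpow_two,
      ← Real.rpow_add ht0, ← Real.rpow_add ht0, ← Real.rpow_add ht0]
    congr 1
    push_cast
    ring
  have h7 : Sig (g t) (k t) i j ^ 2 ≤ 2 * (Cz * Ch * Cg) * (t ^ (-2 + ε)) ^ 2 := by
    rw [Sig, mixed_eq, div_eq_mul_inv, mul_pow]
    refine (mul_le_mul (h1.trans h5) h2 (sq_nonneg _) ?_).trans (le_of_eq ?_)
    · exact mul_nonneg (mul_nonneg (mul_nonneg hCz (hpow t ht0 _)) (mul_nonneg hCh (hpow t ht0 _)))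
        (mul_nonneg hCg (hpow t ht0 _))
    · rw [← h6]
      ring
  have h8 := Real.abs_le_sqrt h7
  rw [Real.sqrt_mul (by positivity), Real.sqrt_sq (hpow t ht0 _)] at h8
  rwa [Real.norm_eq_abs, Real.norm_eq_abs, abs_of_nonneg (hpow t ht0 _)]

end IsSolution

end BianchiV

theorem mainTheorem2 :
    ∃ δ : ℝ, 0 < δ ∧
      ∀ (t₀ : ℝ) (g k : ℝ → BianchiV.Mat3) (f : ℝ → BianchiV.Mom → ℝ),
        0 < t₀ →
        BianchiV.IsSolution t₀ g k f →
        t₀ = -3 / BianchiV.tr (g t₀) (k t₀) →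
        |BianchiV.SigPlus (g t₀) (k t₀)| < δ →
        |BianchiV.SigMinus (g t₀) (k t₀)| < δ →
        (∀ i j, i ≠ j → |BianchiV.Sig (g t₀) (k t₀) i j| < δ) →
        |BianchiV.ATilde (g t₀) (k t₀)| < δ →
        BianchiV.maxMom (g t₀) (f t₀) < δ →
        ∀ ε₀ : ℝ, 0 < ε₀ → ∃ ε : ℝ, 0 < ε ∧ ε < ε₀ ∧
          (∃ u : ℝ → ℝ, u =O[atTop] (fun t : ℝ => t ^ (-ε)) ∧
            ∀ t, t₀ ≤ t → BianchiV.hubble (g t) (k t) = t⁻¹ * (1 + u t)) ∧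
          (fun t => BianchiV.SigPlus (g t) (k t)) =O[atTop] (fun t : ℝ => t ^ (-2 + ε)) ∧
          (fun t => BianchiV.SigMinus (g t) (k t)) =O[atTop] (fun t : ℝ => t ^ (-2 + ε)) ∧
          (∀ i j, i ≠ j →
            (fun t => BianchiV.Sig (g t) (k t) i j) =O[atTop] (fun t : ℝ => t ^ (-2 + ε))) ∧
          (fun t => BianchiV.ATilde (g t) (k t)) =O[atTop] (fun t : ℝ => t ^ (-ε)) ∧
          (fun t => BianchiV.maxMom (g t) (f t)) =O[atTop]
            (fun t : ℝ => t ^ (-(1 / 2 : ℝ) + ε)) := by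
  refine ⟨1 / 600, by norm_num, ?_⟩
  intro t₀ g k f ht₀ sol htr _ _ _ hA hP ε₀ hε₀
  have h0 : BianchiV.hubble (g t₀) (k t₀) = t₀⁻¹ := by
    rw [BianchiV.hubble, htr, inv_div, ← htr]
    ring
  have h0' : 0 < BianchiV.hubble (g t₀) (k t₀) := h0 ▸ inv_pos.2 ht₀
  have hA' := (abs_lt.1 hA).2
  have hP' : ∀ p, f t₀ p ≠ 0 → BianchiV.momSq (g t₀) p ≤ (1 / 600) ^ 2 := fun p hp =>
    (Real.sqrt_le_left (by norm_num)).1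
      ((BianchiV.sqrt_momSq_le_maxMom (sol.density_compact t₀ le_rfl) hp).trans hP.le)
  obtain ⟨C, hC, hall⟩ := sol.first_decay ht₀ h0 hA' hP'
  -- The cap 1/4 lets the rates t^{-1/2} for Ã and 1 - Ht imply t^{-ε}. The momentum rate t^{-3/4}
  -- is better than required for any ε > 0.
  set ε : ℝ := min (ε₀ / 2) (1 / 4) with hεdef
  have hε : 0 < ε := lt_min (by linarith) (by norm_num)
  have hε4 : ε ≤ 1 / 4 := min_le_right _ _
  have hSig : ∀ i j, (fun t => BianchiV.Sig (g t) (k t) i j) =O[atTop]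
      (fun t : ℝ => t ^ (-2 + ε)) :=
    fun i j => sol.shear_decay ht₀ h0 hA' hP' hε (hε4.trans (by norm_num)) i j
  refine ⟨ε, hε, (min_le_left _ _).trans_lt (by linarith),
    ⟨fun t => BianchiV.hubble (g t) (k t) * t - 1, ?_, ?_⟩,
    ((hSig 1 1).add (hSig 2 2)).const_mul_left _, ((hSig 1 1).sub (hSig 2 2)).const_mul_left _,
    fun i j _ => hSig i j, ?_, ?_⟩
  -- From t ≤ 1/H ≤ t + C t^{1/2} it follows that 0 ≤ 1 - Ht ≤ C t^{-1/2}.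
  · refine IsBigO.of_bound C ?_
    filter_upwards [eventually_ge_atTop t₀, eventually_ge_atTop 1] with t ht ht1
    have ht0 := ht₀.trans_le ht
    have hH := sol.hubble_pos h0' ht
    obtain ⟨h1, -, h2, -⟩ := hall t ht
    rw [le_inv_comm₀ ht0 hH] at h1
    rw [inv_le_iff_one_le_mul₀ hH] at h2
    have h3 : BianchiV.hubble (g t) (k t) * t ≤ 1 := by
      have := mul_le_mul_of_nonneg_right h1 ht0.le
      rwa [inv_mul_cancel₀ ht0.ne'] at this
    have h4 : t ^ (1 / 2 : ℝ) = t * t ^ (-(1 / 2) : ℝ) := by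
      rw [← Real.rpow_one_add' ht0.le (by norm_num)]
      norm_num
    have h5 : t ^ (-(1 / 2) : ℝ) ≤ t ^ (-ε) :=
      Real.rpow_le_rpow_of_exponent_le ht1 (by linarith)
    have h6 : 0 ≤ C * t ^ (-(1 / 2) : ℝ) := mul_nonneg hC (Real.rpow_nonneg ht0.le _)
    have h7 := mul_le_mul_of_nonneg_left h3 h6
    have h8 := mul_le_mul_of_nonneg_left h5 hC
    rw [Real.norm_eq_abs, Real.norm_eq_abs, abs_of_nonneg (Real.rpow_nonneg ht0.le _),
      abs_of_nonpos (by linarith)]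
    rw [h4] at h2
    linarith
  · intro t ht
    have ht0 := ht₀.trans_le ht
    field_simp
    ring
  · refine IsBigO.of_bound C ?_
    filter_upwards [eventually_ge_atTop t₀, eventually_ge_atTop 1] with t ht ht1
    have ht0 := ht₀.trans_le ht
    have h1 := (hall t ht).2.2.2.1
    have h5 : t ^ (-(1 / 2) : ℝ) ≤ t ^ (-ε) :=
      Real.rpow_le_rpow_of_exponent_le ht1 (by linarith)
    rw [Real.norm_eq_abs, Real.norm_eq_abs, abs_of_nonneg (Real.rpow_nonneg ht0.le _),
      abs_of_nonneg (sol.ATilde_nonneg h0' ht)]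
    exact h1.trans (mul_le_mul_of_nonneg_left h5 hC)
  · refine IsBigO.of_bound (Real.sqrt C) ?_
    filter_upwards [eventually_ge_atTop t₀, eventually_ge_atTop 1] with t ht ht1
    have ht0 := ht₀.trans_le ht
    have h1 := BianchiV.maxMom_le (hall t ht).2.2.2.2.1
    have h2 : Real.sqrt (t ^ (-(3 / 2) : ℝ)) ≤ t ^ (-(1 / 2 : ℝ) + ε) := by
      rw [Real.sqrt_eq_rpow, ← Real.rpow_mul ht0.le]
      exact Real.rpow_le_rpow_of_exponent_le ht1 (by linarith)
    rw [Real.norm_eq_abs, Real.norm_eq_abs, abs_of_nonneg (Real.rpow_nonneg ht0.le _),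
      abs_of_nonneg (BianchiV.maxMom_nonneg _ _)]
    rw [Real.sqrt_mul hC] at h1
    exact h1.trans (mul_le_mul_of_nonneg_left h2 (Real.sqrt_nonneg _))
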